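/- For $\tau\in\mathbb H=\{\tau\in\mathbb C\mid \operatorname{Im}\tau>0\}$ and $p,q\in\{0,1\}$ let $$\vartheta_{pq}(\tau)=\sum_{n\in\mathbb Z}\exp\Big(\pi i\big(n+\tfrac p2\big)^2\tau+2\pi i\big(n+\tfrac p2\big)\tfrac q2\Big),$$ let $$\mathbb D_{12}=\{\tau\in\mathbb H\mid -1<\operatorname{Re}\tau\le 1,\ |\tau|>1\}\cup\{\tau\in\mathbb H\mid |\tau|=1,\ 0\le\operatorname{Re}\tau\le 1\},$$ a fundamental region of $\Gamma_{12}=\{g=(g_{ij})\in \mathrm{SL}_2(\mathbb Z)\mid g_{11}g_{12}\equiv g_{21}g_{22}\equiv 0 \bmod 2\}$, and set $$\zeta(\tau)=\frac{4\vartheta_{01}(\tau)^4\vartheta_{10}(\tau)^4}{\vartheta_{00}(\tau)^8}\qquad(\tau\in\mathbb D_{12}).$$ For complex $a,b,c$ with $c\neq 0,-1,-2,\dots$ let $F(a,b,c;z)=\sum_{n\ge 0}\frac{(a,n)(b,n)}{(c,n)(1,n)}z^n$ for $|z|<1$, where $(a,n)=a(a+1)\cdots(a+n-1)$. Extend it to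 a single-valued function on $\mathbb C\setminus\{1\}$, still denoted by $F(a,b,c;z)$: on $\mathbb C\setminus[1,\infty)$ it is the analytic continuation of the series, and for $t\in(1,\infty)$ the value $F(a,b,c;t)$ is the limit of $F(a,b,c;z)$ as $z\to t$ with $\operatorname{Im} z>0$. **Theorem.** For $(a,b,c)=(\frac14,\frac14,1)$ and $(a,b,c)=(\frac34,\frac34,1)$ this extension is well defined. For every $\tau\in\mathbb D_{12}$ one has $\vartheta_{00}(\tau)\ne 0$, and $$\zeta(\tau)=1\iff \vartheta_{01}(\tau)^4=\vartheta_{10}(\tau)^4\iff\tau=i .$$ For every $\tau\in\mathbb D_{12}$ with $\tau\neq i$, $$F\Big(\frac14,\frac14,1;\zeta(\tau)\Big)=\vartheta_{00}(\tau)^2,\qquad F\Big(\frac34,\frac34,1;\zeta(\tau)\Big)=\frac{\vartheta_{00}(\tau)^6}{\vartheta_{01}(\tau)^4-\vartheta_{10}(\tau)^4}.$$ At $\tau=i$ the first formula holds in the sense that $\displaystyle\lim_{z\to 1,\ |z|<1}F\Big(\frac14,\frac14,1;z\Big)=\vartheta_{00}(i)^2$. -/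

import Mathlib

open Complex Filter Topology

/-- The theta constant with characteristics `p, q ∈ {0, 1}`,
`ϑ_{pq}(τ) = ∑_{n ∈ ℤ} exp (π i (n + p/2)² τ + 2 π i (n + p/2) (q/2))`,
used for `τ` in the upper half plane. -/
noncomputable def thetaConst (p q : ℕ) (τ : ℂ) : ℂ :=
  ∑' n : ℤ, Complex.exp (Real.pi * I * ((n : ℂ) + p / 2) ^ 2 * τ
    + 2 * Real.pi * I * ((n : ℂ) + p / 2) * (q / 2))

/-- `ζ(τ) = 4 ϑ₀₁(τ)⁴ ϑ₁₀(τ)⁴ / ϑ₀₀(τ)⁸`. -/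
noncomputable def zetaMap (τ : ℂ) : ℂ :=
  4 * thetaConst 0 1 τ ^ 4 * thetaConst 1 0 τ ^ 4 / thetaConst 0 0 τ ^ 8

/-- The fundamental region `𝔻₁₂` of `Γ₁₂` in the upper half plane. -/
def regionD12 : Set ℂ :=
  {τ : ℂ | 0 < τ.im ∧ -1 < τ.re ∧ τ.re ≤ 1 ∧ 1 < ‖τ‖} ∪
    {τ : ℂ | 0 < τ.im ∧ ‖τ‖ = 1 ∧ 0 ≤ τ.re ∧ τ.re ≤ 1}

/-- The simply connected domain `ℂ ∖ [1, ∞)`. -/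
def cutPlane : Set ℂ := {z : ℂ | z.im = 0 → z.re < 1}

/-- `f` is the single-valued extension to `ℂ ∖ {1}` of the hypergeometric series `F(a, b, c; z)`:
the analytic continuation of the series from the unit disk to `ℂ ∖ [1, ∞)`, and at `t ∈ (1, ∞)`
its limit as `z → t` with `Im z > 0`. The value at `1` is irrelevant. -/
structure IsSingleValuedHypergeometric (a b c : ℂ) (f : ℂ → ℂ) : Prop where
  differentiableOn : DifferentiableOn ℂ f cutPlane
  eq_series : ∀ z : ℂ, ‖z‖ < 1 → f z = ordinaryHypergeometric a b c z
  tendsto_of_one_lt : ∀ t : ℝ, 1 < t →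
    Tendsto f (𝓝[{z : ℂ | 0 < z.im}] (t : ℂ)) (𝓝 (f (t : ℂ)))

theorem mem_cutPlane {z : ℂ} : z ∈ cutPlane ↔ (z.im = 0 → z.re < 1) := Iff.rfl

theorem isOpen_cutPlane : IsOpen cutPlane := by
  have h : cutPlane = {z : ℂ | z.im ≠ 0} ∪ {z : ℂ | z.re < 1} := by
    ext z
    change (z.im = 0 → z.re < 1) ↔ (z.im ≠ 0 ∨ z.re < 1)
    tauto
  rw [h]
  exact (isOpen_ne_fun continuous_im continuous_const).union
    (isOpen_lt continuous_re continuous_const)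

theorem isPreconnected_cutPlane : IsPreconnected cutPlane := by
  have h : StarConvex ℝ (0 : ℂ) cutPlane := by
    refine starConvex_zero_iff.2 fun z hz s hs0 hs1 => ?_
    simp only [mem_cutPlane, real_smul, mul_im, mul_re, ofReal_re, ofReal_im,
      zero_mul, add_zero, sub_zero] at hz ⊢
    intro h
    rcases mul_eq_zero.1 h with h | h
    · simp [h]
    · have := hz h
      rcases le_or_gt z.re 0 with h0 | h0
      · linarith [mul_nonneg hs0 (neg_nonneg.2 h0)]
      · linarith [mul_le_mul_of_nonneg_right hs1 h0.le]
  exact (h.isPathConnected (by simp [mem_cutPlane])).isConnected.isPreconnected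

/-- The single-valued extension is unique on `ℂ ∖ {1}`. -/
theorem IsSingleValuedHypergeometric.eqOn {a b c : ℂ} {f g : ℂ → ℂ}
    (hf : IsSingleValuedHypergeometric a b c f) (hg : IsSingleValuedHypergeometric a b c g) :
    Set.EqOn f g {z : ℂ | z ≠ 1} := by
  have hcut : Set.EqOn f g cutPlane := by
    refine (hf.differentiableOn.analyticOnNhd isOpen_cutPlane).eqOn_of_preconnected_of_eventuallyEq
      (hg.differentiableOn.analyticOnNhd isOpen_cutPlane) isPreconnected_cutPlane
      (z₀ := 0) (by simp [mem_cutPlane]) ?_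
    filter_upwards [Metric.ball_mem_nhds (0 : ℂ) one_pos] with z hz
    have hz' : ‖z‖ < 1 := by simpa using hz
    rw [hf.eq_series z hz', hg.eq_series z hz']
  intro z hz
  by_cases h : z ∈ cutPlane
  · exact hcut h
  · simp only [mem_cutPlane, not_forall, not_lt] at h
    obtain ⟨him, hre⟩ := h
    have hzt : z = ((z.re : ℝ) : ℂ) := Complex.ext (by simp) (by simp [him])
    have hlt : 1 < z.re := by
      refine lt_of_le_of_ne hre fun h1 => hz ?_
      rw [hzt, ← h1]
      simp
    have hne : (𝓝[{w : ℂ | 0 < w.im}] ((z.re : ℝ) : ℂ)).NeBot := by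
      rw [← mem_closure_iff_nhdsWithin_neBot, Complex.closure_setOfPred_lt_im]
      simp
    rw [hzt]
    refine tendsto_nhds_unique (hf.tendsto_of_one_lt _ hlt)
      ((hg.tendsto_of_one_lt _ hlt).congr' ?_)
    filter_upwards [self_mem_nhdsWithin] with w hw
    have hw' : 0 < w.im := hw
    exact (hcut (fun h0 => absurd h0 hw'.ne')).symm

open Classical in
/-- The hypergeometric function `F(a, b, c; z)` as a single-valued function on `ℂ ∖ {1}`
(with an unspecified value at `z = 1`). -/
noncomputable def hypergeometricF (a b c : ℂ) : ℂ → ℂ :=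
  if h : ∃ f : ℂ → ℂ, IsSingleValuedHypergeometric a b c f then Classical.choose h else 0

/-! Let λ = ϑ₁₀⁴/ϑ₀₀⁴. Jacobi's identity gives ζ = 4λ(1-λ), hence 1-ζ = (1-2λ)². The quadratic
transformations F(1/4,1/4,1;4u(1-u)) = F(1/2,1/2,1;u) and (1-2u)F(3/4,3/4,1;4u(1-u)) =
F(1/2,1/2,1;u) reduce both formulas to the classical F(1/2,1/2,1;λ) = ϑ₀₀², provided that the chosen
square root of 1-ζ is 1-2λ.

Landen's transformation continues F(1/2,1/2,1;u) to the cut plane (`halfExt`). Composing it with u =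
(1-√(1-z))/2, where Re u ≤ 1/2, gives `quarterExt`, which even stays continuous at z = 1. By the
doubling formulas, F(1/2,1/2,1;λ)/ϑ₀₀² is invariant under τ ↦ 2τ high in the half plane, and it
tends to 1 at i∞, so it is 1 there. The identity theorem and continuity carry this to the closed
region (`halfExt_modLambda`).

The branch is the delicate point: Re λ < 1/2 is needed off the arc |τ| = 1, and Im λ > 0 on the part
of the arc with Re τ > 0. The first says |λ(τ+1)| = |λ/(1-λ)| < 1, which follows from the maximum
principle (`norm_modLambda_add_one_lt_one`). On the arc Re λ = 1/2; there λ = 1/2 only at i, so Im λ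
has constant sign on the right half, and the positive Taylor coefficients of F(1/2,1/2,1;·)
determine that sign near i (`im_modLambda_pos`). -/

/-! ### Power series and the hypergeometric equation -/

theorem Complex.enorm_lt_one_iff {z : ℂ} : ‖z‖ₑ < 1 ↔ ‖z‖ < 1 := by
  rw [← ENNReal.coe_one, enorm_lt_coe]
  exact Iff.rfl

/-- Derivative of a function given by a power series on the unit disc. -/
theorem hasSum_deriv_of_hasSum {f : ℂ → ℂ} {e : ℕ → ℂ}
    (hf : ∀ z : ℂ, ‖z‖ < 1 → HasSum (fun n => e n * z ^ n) (f z)) :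
    DifferentiableOn ℂ f (Metric.ball 0 1) ∧
      ∀ z : ℂ, ‖z‖ < 1 → HasSum (fun n : ℕ => ((n : ℂ) + 1) * e (n + 1) * z ^ n) (deriv f z) := by
  set p : FormalMultilinearSeries ℂ ℂ ℂ := FormalMultilinearSeries.ofScalars ℂ e with hp
  have hps : HasFPowerSeriesOnBall f p 0 1 := by
    refine ⟨?_, one_pos, ?_⟩
    -- The radius is at least 1 because the terms tend to 0 at every real r < 1.
    · refine ENNReal.le_of_forall_nnreal_lt fun r hr => ?_
      have hr' : ‖((r : ℝ) : ℂ)‖ < 1 := by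
        simpa using hr
      have h0 := (hf _ hr').summable.norm.tendsto_atTop_zero
      refine FormalMultilinearSeries.le_radius_of_tendsto (l := 0) _ ?_
      refine h0.congr fun n => ?_
      simp [hp]
    · intro y hy
      have hy' : ‖y‖ < 1 := by
        exact Complex.enorm_lt_one_iff.1 (by simpa using hy)
      simpa [hp, mul_comm] using hf y hy'
  have hd : DifferentiableOn ℂ f (Metric.ball 0 1) := by
    have := hps.differentiableOn
    rwa [show (1 : ENNReal) = ENNReal.ofReal 1 by simp, Metric.eball_ofReal] at this
  refine ⟨hd, fun z hz => ?_⟩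
  have hcoef : ∀ n, e n = (n.factorial : ℂ)⁻¹ * iteratedDeriv n f 0 := by
    intro n
    have h1 := hps.factorial_smul (1 : ℂ) n
    rw [← iteratedDeriv_eq_iteratedFDeriv] at h1
    rw [← h1]
    simp [hp, Nat.factorial_ne_zero]
  have h2 := Complex.hasSum_taylorSeries_on_ball (f := deriv f) (c := 0) (r := 1) (z := z)
    (hd.deriv Metric.isOpen_ball) (by simpa using hz)
  refine h2.congr_fun fun n => ?_
  rw [hcoef (n + 1), iteratedDeriv_succ', Nat.factorial_succ]
  have : (n.factorial : ℂ) ≠ 0 := by exact_mod_cast Nat.factorial_ne_zero n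
  have h3 : (n : ℂ) + 1 ≠ 0 := by exact_mod_cast Nat.succ_ne_zero n
  simp only [smul_eq_mul, sub_zero]
  push_cast
  field_simp

theorem hasSum_nat_mul_of_hasSum_succ {e : ℕ → ℂ} {z s : ℂ}
    (h : HasSum (fun n : ℕ => e (n + 1) * z ^ n) s) (h0 : e 0 = 0) :
    HasSum (fun n : ℕ => e n * z ^ n) (z * s) := by
  rw [← hasSum_nat_add_iff' 1]
  simpa [h0, pow_succ, mul_comm, mul_left_comm, mul_assoc] using h.mul_left z

theorem hasSum_ordinaryHypergeometric {a b c : ℂ}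
    (habc : ∀ k : ℕ, (k : ℂ) ≠ -a ∧ (k : ℂ) ≠ -b ∧ (k : ℂ) ≠ -c)
    {z : ℂ} (hz : ‖z‖ < 1) :
    HasSum (fun n => ordinaryHypergeometricCoefficient a b c n * z ^ n)
      (ordinaryHypergeometric a b c z) := by
  have hr := ordinaryHypergeometricSeries_radius_eq_one ℂ a b c habc
  have := (ordinaryHypergeometricSeries ℂ a b c).hasSum (x := z) (by
    rw [hr]
    simpa [Complex.enorm_lt_one_iff] using hz)
  refine this.congr_fun fun n => ?_
  simp [ordinaryHypergeometricSeries, mul_comm]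

theorem ordinaryHypergeometricCoefficient_succ (a : ℂ) (n : ℕ) :
    ((n : ℂ) + 1) ^ 2 * ordinaryHypergeometricCoefficient a a 1 (n + 1)
      = (a + n) ^ 2 * ordinaryHypergeometricCoefficient a a 1 n := by
  have h3 : (n : ℂ) + 1 ≠ 0 := by exact_mod_cast Nat.succ_ne_zero n
  have h5 : 1 + (n : ℂ) ≠ 0 := by rwa [add_comm]
  have h4 : (n.factorial : ℂ) ≠ 0 := by exact_mod_cast Nat.factorial_ne_zero n
  simp only [ordinaryHypergeometricCoefficient, ascPochhammer_succ_eval, Nat.factorial_succ,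
    ascPochhammer_eval_one]
  push_cast
  field_simp
  ring

/-- The hypergeometric differential equation for `F(a, a, 1; z)`. -/
theorem ordinaryHypergeometric_ode {a : ℂ} (ha : ∀ k : ℕ, (k : ℂ) ≠ -a) :
    DifferentiableOn ℂ (ordinaryHypergeometric a a 1 : ℂ → ℂ) (Metric.ball 0 1) ∧
    ∀ z : ℂ, ‖z‖ < 1 →
      z * (1 - z) * deriv (deriv (ordinaryHypergeometric a a 1)) z
        + (1 - (2 * a + 1) * z) * deriv (ordinaryHypergeometric a a 1) z
        = a ^ 2 * ordinaryHypergeometric a a 1 z := by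
  set f : ℂ → ℂ := ordinaryHypergeometric a a 1 with hf
  set e : ℕ → ℂ := ordinaryHypergeometricCoefficient a a 1 with he
  have hone : ∀ k : ℕ, (k : ℂ) ≠ -1 := fun k hk => by
    have := congrArg re hk
    simp at this
    have h0 : (0 : ℝ) ≤ k := k.cast_nonneg
    linarith
  have h0 : ∀ z : ℂ, ‖z‖ < 1 → HasSum (fun n => e n * z ^ n) (f z) := fun z hz =>
    hasSum_ordinaryHypergeometric (fun k => ⟨ha k, ha k, hone k⟩) hz
  obtain ⟨hd, h1⟩ := hasSum_deriv_of_hasSum h0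
  obtain ⟨-, h2⟩ := hasSum_deriv_of_hasSum h1
  refine ⟨hd, fun z hz => ?_⟩
  have H0 := h0 z hz
  have H1 := h1 z hz
  have H1z : HasSum (fun n : ℕ => (n : ℂ) * e n * z ^ n) (z * deriv f z) :=
    hasSum_nat_mul_of_hasSum_succ (e := fun n => (n : ℂ) * e n) (by simpa using H1) (by simp)
  have H2 : HasSum (fun n : ℕ => ((n : ℂ) * (n + 1) * e (n + 1)) * z ^ n)
      (z * deriv (deriv f) z) := by
    refine hasSum_nat_mul_of_hasSum_succ (e := fun n => (n : ℂ) * (n + 1) * e (n + 1)) ?_ (by simp)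
    refine (h2 z hz).congr_fun fun n => ?_
    push_cast
    ring
  have H3 : HasSum (fun n : ℕ => ((n : ℂ) * (n - 1) * e n) * z ^ n)
      (z * (z * deriv (deriv f) z)) := by
    refine hasSum_nat_mul_of_hasSum_succ (e := fun n => (n : ℂ) * (n - 1) * e n) ?_ (by simp)
    refine H2.congr_fun fun n => ?_
    push_cast
    ring
  have H := ((H2.add H1).sub ((H3.add (H1z.mul_left (2 * a + 1))).add (H0.mul_left (a ^ 2))))
  -- The equation holds coefficientwise: it is the recurrence (n+1)² e(n+1) = (a+n)² e(n).
  have hz0 : ∀ n : ℕ, (n : ℂ) * (n + 1) * e (n + 1) * z ^ n + (n + 1) * e (n + 1) * z ^ n -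
      ((n : ℂ) * (n - 1) * e n * z ^ n + (2 * a + 1) * (n * e n * z ^ n) + a ^ 2 * (e n * z ^ n))
      = 0 := by
    intro n
    linear_combination z ^ n * ordinaryHypergeometricCoefficient_succ a n
  simp only [hz0] at H
  have := H.unique hasSum_zero
  linear_combination this

/-! ### Uniqueness at a regular singular point; quadratic transformations -/

/-- Uniqueness for `(P y')' = Q y` at a regular singular point: the Wronskian of two solutions
that are regular at `0` vanishes. -/
theorem eventuallyEq_of_wronskian {f f' g g' P Q : ℂ → ℂ}
    (hf : ∀ᶠ z in 𝓝 0, HasDerivAt f (f' z) z)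
    (hf' : ∀ᶠ z in 𝓝 0, HasDerivAt (fun w => P w * f' w) (Q z * f z) z)
    (hg : ∀ᶠ z in 𝓝 0, HasDerivAt g (g' z) z)
    (hg' : ∀ᶠ z in 𝓝 0, HasDerivAt (fun w => P w * g' w) (Q z * g z) z)
    (hP : P 0 = 0) (hP' : ∀ᶠ z in 𝓝[≠] 0, P z ≠ 0) (hfg : f 0 = g 0) (hg0 : g 0 ≠ 0) :
    f =ᶠ[𝓝 0] g := by
  have hgne : ∀ᶠ z in 𝓝 0, g z ≠ 0 := hg.self_of_nhds.continuousAt.eventually_ne hg0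
  obtain ⟨ε, hε, hball⟩ := Metric.eventually_nhds_iff_ball.1
    (hf.and (hf'.and (hg.and (hg'.and (hgne.and (eventually_nhdsWithin_iff.1 hP'))))))
  set B : Set ℂ := Metric.ball 0 ε
  have hBo : IsOpen B := Metric.isOpen_ball
  have hBc : IsPreconnected B := (convex_ball (0 : ℂ) ε).isPreconnected
  have h0B : (0 : ℂ) ∈ B := Metric.mem_ball_self hε
  have hconst : ∀ {k : ℂ → ℂ}, (∀ z ∈ B, HasDerivAt k 0 z) → ∀ z ∈ B, k z = k 0 := by
    intro k hk z hz
    refine hBo.is_const_of_deriv_eq_zero hBc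
      (fun w hw => (hk w hw).differentiableAt.differentiableWithinAt)
      (fun w hw => (hk w hw).deriv) hz h0B
  have hW : ∀ z ∈ B, f z * (P z * g' z) - g z * (P z * f' z) = 0 := by
    intro z hz
    have := hconst (k := fun z => f z * (P z * g' z) - g z * (P z * f' z)) (fun w hw => by
      obtain ⟨h1, h2, h3, h4, -, -⟩ := hball w hw
      convert! (h1.mul h4).sub (h3.mul h2) using 1
      ring) z hz
    simpa [hP] using this
  have hoff : ∀ z ∈ B, z ≠ 0 → f' z * g z - f z * g' z = 0 := by
    intro z hz hz0
    have h1 := hW z hz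
    have h2 := (hball z hz).2.2.2.2.2 hz0
    refine (mul_eq_zero.1 (?_ : P z * (f' z * g z - f z * g' z) = 0)).resolve_left h2
    linear_combination -h1
  -- A complex derivative is automatically continuous, so the Wronskian relation found off 0 also
  -- holds at 0.
  have hcont : ∀ {k k' : ℂ → ℂ}, (∀ z ∈ B, HasDerivAt k (k' z) z) → ContinuousAt k' 0 := by
    intro k k' hk
    have hd : DifferentiableOn ℂ (deriv k) B :=
      DifferentiableOn.deriv (fun w hw => (hk w hw).differentiableAt.differentiableWithinAt) hBo
    refine ((hd.differentiableAt (hBo.mem_nhds h0B)).continuousAt).congr ?_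
    filter_upwards [hBo.mem_nhds h0B] with w hw using (hk w hw).deriv
  have hf0 := hcont (fun z hz => (hball z hz).1)
  have hg0' := hcont (fun z hz => (hball z hz).2.2.1)
  have hat0 : f' 0 * g 0 - f 0 * g' 0 = 0 := by
    have hc : ContinuousAt (fun z => f' z * g z - f z * g' z) 0 :=
      (hf0.mul hg.self_of_nhds.continuousAt).sub (hf.self_of_nhds.continuousAt.mul hg0')
    refine tendsto_nhds_unique (hc.tendsto.mono_left nhdsWithin_le_nhds)
      (tendsto_const_nhds.congr' (f₁ := fun _ => (0 : ℂ)) (l₁ := 𝓝[≠] (0 : ℂ)) ?_)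
    filter_upwards [self_mem_nhdsWithin, mem_nhdsWithin_of_mem_nhds (hBo.mem_nhds h0B)] with z h1 h2
      using (hoff z h2 h1).symm
  filter_upwards [hBo.mem_nhds h0B] with z hz
  have h := hconst (k := fun z => f z / g z) (fun w hw => by
    obtain ⟨h1, -, h3, -, h5, -⟩ := hball w hw
    convert! h1.div h3 h5 using 1
    rw [eq_comm, div_eq_zero_iff]
    left
    by_cases hw0 : w = 0
    · rw [hw0, hat0]
    · exact hoff w hw hw0) z hz
  simp only [hfg, div_self hg0] at h
  exact (div_eq_one_iff_eq (hball z hz).2.2.2.2.1).1 h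

theorem natCast_ne_neg_of_re_pos {a : ℂ} (ha : 0 < a.re) (k : ℕ) : (k : ℂ) ≠ -a := fun h => by
  have := congrArg re h
  simp only [natCast_re, neg_re] at this
  have h0 : (0 : ℝ) ≤ k := k.cast_nonneg
  linarith

/-- The hypergeometric series `F(a, a, 1; z)`. -/
noncomputable def hypDiag (a z : ℂ) : ℂ := ordinaryHypergeometric a a 1 z

@[simp] theorem hypDiag_zero (a : ℂ) : hypDiag a 0 = 1 := ordinaryHypergeometric_zero a a 1

/-- `F(a, a, 1; ·)` with its derivatives on the unit disc. -/
theorem hypDiag_hasDerivAt {a : ℂ} (ha : 0 < a.re) {z : ℂ} (hz : ‖z‖ < 1) :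
    HasDerivAt (hypDiag a) (deriv (hypDiag a) z) z ∧
    HasDerivAt (deriv (hypDiag a))
      (deriv (deriv (hypDiag a)) z) z ∧
    z * (1 - z) * deriv (deriv (hypDiag a)) z
        + (1 - (2 * a + 1) * z) * deriv (hypDiag a) z
        = a ^ 2 * hypDiag a z := by
  obtain ⟨hd, h⟩ := ordinaryHypergeometric_ode (natCast_ne_neg_of_re_pos ha)
  have hm : Metric.ball (0 : ℂ) 1 ∈ 𝓝 z := Metric.isOpen_ball.mem_nhds (by simpa using hz)
  exact ⟨(hd.differentiableAt hm).hasDerivAt,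
    ((hd.deriv Metric.isOpen_ball).differentiableAt hm).hasDerivAt, h z hz⟩

theorem eventually_norm_lt_one {φ : ℂ → ℂ} (hφ : ContinuousAt φ 0) (h0 : φ 0 = 0) :
    ∀ᶠ z in 𝓝 0, ‖φ z‖ < 1 := by
  have := hφ.norm.eventually_lt (continuousAt_const (y := (1 : ℝ))) (by simp [h0])
  exact this

/-- `(u(1-u) y')' = y / 4` for `y = F(1/2, 1/2, 1; u)`. -/
theorem hypDiag_half_ode {u : ℂ} (hu : ‖u‖ < 1) :
    HasDerivAt (fun w => w * (1 - w) * deriv (hypDiag (1 / 2)) w)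
      (1 / 4 * hypDiag (1 / 2) u) u := by
  obtain ⟨-, h2, h3⟩ := hypDiag_hasDerivAt (a := 1 / 2) (by norm_num) hu
  convert! ((hasDerivAt_id u).mul ((hasDerivAt_id u).const_sub 1)).mul h2 using 1
  simp only [id, Pi.mul_apply]
  linear_combination -h3

theorem eventually_quadratic_ne_zero : ∀ᶠ u : ℂ in 𝓝[≠] 0, u * (1 - u) ≠ 0 := by
  have h : ∀ᶠ u : ℂ in 𝓝 0, u ≠ 1 := eventually_ne_nhds zero_ne_one
  filter_upwards [self_mem_nhdsWithin, mem_nhdsWithin_of_mem_nhds h] with u h1 h2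
  exact mul_ne_zero h1 (sub_ne_zero.2 (Ne.symm h2))

theorem hasDerivAt_four_mul_mul_one_sub (u : ℂ) :
    HasDerivAt (fun u : ℂ => 4 * u * (1 - u)) (4 * (1 - 2 * u)) u := by
  convert! ((hasDerivAt_id u).const_mul 4).mul ((hasDerivAt_id u).const_sub 1) using 1
  simp only [id]
  ring

/-- `F(1/4, 1/4, 1; 4u(1-u)) = F(1/2, 1/2, 1; u)` near `0`. -/
theorem hypDiag_quarter_quadratic :
    (fun u => hypDiag (1 / 4) (4 * u * (1 - u)) : ℂ → ℂ)
      =ᶠ[𝓝 0] hypDiag (1 / 2) := by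
  set F := hypDiag (1 / 4)
  have hφ : ∀ᶠ u : ℂ in 𝓝 0, ‖4 * u * (1 - u)‖ < 1 :=
    eventually_norm_lt_one (φ := fun u => 4 * u * (1 - u)) (by fun_prop) (by simp)
  have h1 : ∀ᶠ u : ℂ in 𝓝 0, ‖u‖ < 1 := eventually_norm_lt_one continuousAt_id rfl
  -- Both sides solve (u(1-u)y')' = y/4: for z = 4u(1-u) one has 1-z = (1-2u)² and dz/du = 4(1-2u),
  -- which pulls the equation for a = 1/4 back to the one for a = 1/2.
  refine eventuallyEq_of_wronskian (f' := fun u => deriv F (4 * u * (1 - u)) * (4 * (1 - 2 * u)))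
    (g' := deriv (hypDiag (1 / 2))) (P := fun u => u * (1 - u))
    (Q := fun _ => 1 / 4) ?_ ?_ ?_ ?_ (by simp) eventually_quadratic_ne_zero (by simp [F]) (by simp)
  · filter_upwards [hφ] with u hu
    obtain ⟨hF, -, -⟩ := hypDiag_hasDerivAt (a := 1 / 4) (by norm_num) hu
    exact hF.comp u (hasDerivAt_four_mul_mul_one_sub u)
  · filter_upwards [hφ] with u hu
    obtain ⟨-, hF, hode⟩ := hypDiag_hasDerivAt (a := 1 / 4) (by norm_num) hu
    have hd := hasDerivAt_four_mul_mul_one_sub u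
    convert! ((hasDerivAt_id u).mul ((hasDerivAt_id u).const_sub 1)).mul ((hF.comp u hd).mul
      ((((hasDerivAt_id u).const_mul 2).const_sub 1).const_mul 4)) using 1
    simp only [id, Function.comp_apply, Pi.mul_apply, F]
    linear_combination -4 * hode
  · filter_upwards [h1] with u hu
    exact (hypDiag_hasDerivAt (a := 1 / 2) (by norm_num) hu).1
  · filter_upwards [h1] with u hu using hypDiag_half_ode hu

/-- `(1-2u) F(3/4, 3/4, 1; 4u(1-u)) = F(1/2, 1/2, 1; u)` near `0`. -/
theorem hypDiag_three_quarters_quadratic :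
    (fun u => (1 - 2 * u) * hypDiag (3 / 4) (4 * u * (1 - u)) : ℂ → ℂ)
      =ᶠ[𝓝 0] hypDiag (1 / 2) := by
  set F := hypDiag (3 / 4)
  have hφ : ∀ᶠ u : ℂ in 𝓝 0, ‖4 * u * (1 - u)‖ < 1 :=
    eventually_norm_lt_one (φ := fun u => 4 * u * (1 - u)) (by fun_prop) (by simp)
  have h1 : ∀ᶠ u : ℂ in 𝓝 0, ‖u‖ < 1 := eventually_norm_lt_one continuousAt_id rfl
  have hlin : ∀ u : ℂ, HasDerivAt (fun u : ℂ => 1 - 2 * u) (-2) u := fun u => by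
    simpa using ((hasDerivAt_id u).const_mul 2).const_sub 1
  refine eventuallyEq_of_wronskian
    (f' := fun u => -2 * F (4 * u * (1 - u))
      + (1 - 2 * u) * (deriv F (4 * u * (1 - u)) * (4 * (1 - 2 * u))))
    (g' := deriv (hypDiag (1 / 2))) (P := fun u => u * (1 - u))
    (Q := fun _ => 1 / 4) ?_ ?_ ?_ ?_ (by simp) eventually_quadratic_ne_zero (by simp [F]) (by simp)
  · filter_upwards [hφ] with u hu
    obtain ⟨hF, -, -⟩ := hypDiag_hasDerivAt (a := 3 / 4) (by norm_num) hu
    exact (hlin u).mul (hF.comp u (hasDerivAt_four_mul_mul_one_sub u))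
  · filter_upwards [hφ] with u hu
    obtain ⟨hF, hF', hode⟩ := hypDiag_hasDerivAt (a := 3 / 4) (by norm_num) hu
    have hd := hasDerivAt_four_mul_mul_one_sub u
    convert! ((hasDerivAt_id u).mul ((hasDerivAt_id u).const_sub 1)).mul
      (((hF.comp u hd).const_mul (-2)).add ((hlin u).mul ((hF'.comp u hd).mul
        ((hlin u).const_mul 4)))) using 1
    simp only [id, Function.comp_apply, Pi.mul_apply, Pi.add_apply, F]
    linear_combination -4 * (1 - 2 * u) * hode
  · filter_upwards [h1] with u hu
    exact (hypDiag_hasDerivAt (a := 1 / 2) (by norm_num) hu).1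
  · filter_upwards [h1] with u hu using hypDiag_half_ode hu

/-- Landen's transformation `F(1/2, 1/2, 1; 4x/(1+x)²) = (1+x) F(1/2, 1/2, 1; x²)` near `0`. -/
theorem hypDiag_half_landen :
    (fun x => hypDiag (1 / 2) (4 * x / (1 + x) ^ 2) / (1 + x) : ℂ → ℂ)
      =ᶠ[𝓝 0] fun x => hypDiag (1 / 2) (x ^ 2) := by
  set G := hypDiag (1 / 2)
  have hφ : ∀ᶠ x : ℂ in 𝓝 0, ‖4 * x / (1 + x) ^ 2‖ < 1 :=
    eventually_norm_lt_one (φ := fun x => 4 * x / (1 + x) ^ 2)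
      (ContinuousAt.div (by fun_prop) (by fun_prop) (by simp)) (by simp)
  have h1 : ∀ᶠ x : ℂ in 𝓝 0, ‖x‖ < 1 := eventually_norm_lt_one continuousAt_id rfl
  have h2 : ∀ᶠ x : ℂ in 𝓝 0, ‖x ^ 2‖ < 1 := eventually_norm_lt_one (by fun_prop) (by simp)
  have hne : ∀ {x : ℂ}, ‖x‖ < 1 → 1 + x ≠ 0 := fun {x} hx h => by
    rw [show x = -1 by linear_combination h] at hx
    simp at hx
  have hadd : ∀ x : ℂ, HasDerivAt (fun x : ℂ => 1 + x) 1 x := fun x =>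
    (hasDerivAt_id x).const_add 1
  have hd : ∀ {x : ℂ}, ‖x‖ < 1 → HasDerivAt (fun x : ℂ => 4 * x / (1 + x) ^ 2)
      (4 * (1 - x) / (1 + x) ^ 3) x := by
    intro x hx
    have := hne hx
    convert! ((hasDerivAt_id x).const_mul 4).div ((hadd x).fun_pow 2) (pow_ne_zero 2 this) using 1
    simp only [id]
    field_simp
    ring
  have hsq : ∀ x : ℂ, HasDerivAt (fun x : ℂ => x ^ 2) (2 * x) x := fun x => by
    simpa using hasDerivAt_pow 2 x
  -- The common equation is (x(1-x²)y')' = xy.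
  refine eventuallyEq_of_wronskian
    (f' := fun x => deriv G (4 * x / (1 + x) ^ 2) * (4 * (1 - x) / (1 + x) ^ 4)
      - G (4 * x / (1 + x) ^ 2) / (1 + x) ^ 2)
    (g' := fun x => deriv G (x ^ 2) * (2 * x)) (P := fun x => x * (1 - x ^ 2))
    (Q := fun x => x) ?_ ?_ ?_ ?_ (by simp) ?_ (by simp [G]) (by simp [G])
  · filter_upwards [hφ, h1] with x hx hx1
    obtain ⟨hF, -, -⟩ := hypDiag_hasDerivAt (a := 1 / 2) (by norm_num) hx
    have := hne hx1
    convert! (hF.comp x (hd hx1)).div (hadd x) this using 1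
    simp only [Function.comp_apply]
    field_simp
    ring
  · filter_upwards [hφ, h1] with x hx hx1
    obtain ⟨hF, -, -⟩ := hypDiag_hasDerivAt (a := 1 / 2) (by norm_num) hx
    have h3 := hne hx1
    -- With u = 4x/(1+x)² one has 1-u = (1-x)²/(1+x)². Isolating u(1-u)G'(u) lets the equation of G
    -- be used in divergence form.
    have hfun : (fun x => x * (1 - x ^ 2) * (deriv G (4 * x / (1 + x) ^ 2)
        * (4 * (1 - x) / (1 + x) ^ 4) - G (4 * x / (1 + x) ^ 2) / (1 + x) ^ 2)) =ᶠ[𝓝 x]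
        fun x => (1 + x) * (4 * x / (1 + x) ^ 2 * (1 - 4 * x / (1 + x) ^ 2)
          * deriv G (4 * x / (1 + x) ^ 2))
          - x * (1 - x) / (1 + x) * G (4 * x / (1 + x) ^ 2) := by
      filter_upwards [(hadd x).continuousAt.eventually_ne h3] with w hw
      field_simp
      ring
    refine HasDerivAt.congr_of_eventuallyEq ?_ hfun
    have hG := (hypDiag_half_ode hx).comp x (hd hx1)
    have hq : HasDerivAt (fun x : ℂ => x * (1 - x) / (1 + x))
        ((1 - 2 * x - x ^ 2) / (1 + x) ^ 2) x := by
      convert! ((hasDerivAt_id x).mul ((hasDerivAt_id x).const_sub 1)).div (hadd x) h3 using 1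
      simp only [id, Pi.mul_apply]
      ring
    convert! ((hadd x).mul hG).sub (hq.mul (hF.comp x (hd hx1))) using 1
    simp only [Function.comp_apply]
    field_simp
    ring
  · filter_upwards [h2] with x hx
    obtain ⟨hF, -, -⟩ := hypDiag_hasDerivAt (a := 1 / 2) (by norm_num) hx
    exact hF.comp x (hsq x)
  · filter_upwards [h2] with x hx
    convert! ((hypDiag_half_ode hx).comp x (hsq x)).const_mul 2 using 1
    · ext w
      simp only [Function.comp_apply]
      ring
    · ring
  · filter_upwards [self_mem_nhdsWithin, mem_nhdsWithin_of_mem_nhds h1] with x hx0 hx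
    have h3 := hne hx
    have h4 := hne (x := -x) (by simpa using hx)
    rw [show x * (1 - x ^ 2) = x * ((1 + x) * (1 + -x)) by ring]
    exact mul_ne_zero hx0 (mul_ne_zero h3 h4)

/-! ### The branch of √(1-z) -/

open scoped ComplexConjugate in
/-- The square root of `1 - z` that is holomorphic on `ℂ ∖ [1, ∞)` with positive real part, and
continuous from above on `[1, ∞)`. -/
noncomputable def sqrtOneSub (z : ℂ) : ℂ := conj (Complex.sqrt (1 - conj z))

theorem Complex.sqrt_pow_two (z : ℂ) : Complex.sqrt z ^ 2 = z := cpow_ofNat_inv_pow z 2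

theorem Complex.sqrt_of_pow_two {v : ℂ} (h : 0 < v.re ∨ (v.re = 0 ∧ 0 ≤ v.im)) :
    Complex.sqrt (v ^ 2) = v :=
  pow_cpow_ofNat_inv (neg_pi_div_two_lt_arg_iff.2 (h.imp id And.right))
    (arg_le_pi_div_two_iff.2 (Or.inl (h.elim le_of_lt fun h => h.1.ge)))

theorem Complex.re_sqrt_nonneg (z : ℂ) : 0 ≤ (Complex.sqrt z).re := by
  rw [Complex.sqrt, cpow_inv_two_re]
  exact Real.sqrt_nonneg _

theorem Complex.re_sqrt_pos {z : ℂ} (hz : z ∈ slitPlane) : 0 < (Complex.sqrt z).re := by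
  rw [Complex.sqrt, cpow_inv_two_re]
  refine Real.sqrt_pos.2 (half_pos ?_)
  rcases hz with h | h
  · exact add_pos_of_nonneg_of_pos (norm_nonneg z) h
  · have := abs_re_lt_norm.2 h
    linarith [neg_abs_le z.re]

theorem one_sub_mem_slitPlane {z : ℂ} (hz : z ∈ cutPlane) : 1 - z ∈ slitPlane := by
  rw [mem_slitPlane_iff]
  by_cases h : z.im = 0
  · left
    simpa using mem_cutPlane.1 hz h
  · right
    simpa using h

theorem mem_cutPlane_of_re_lt_one {z : ℂ} (hz : z.re < 1) : z ∈ cutPlane := fun _ => hz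

theorem mem_cutPlane_of_norm_lt_one {z : ℂ} (hz : ‖z‖ < 1) : z ∈ cutPlane :=
  mem_cutPlane_of_re_lt_one ((re_le_norm z).trans_lt hz)

theorem sqrtOneSub_sq (z : ℂ) : sqrtOneSub z ^ 2 = 1 - z := by
  simp [sqrtOneSub, ← map_pow, Complex.sqrt_pow_two]

theorem re_sqrtOneSub_nonneg (z : ℂ) : 0 ≤ (sqrtOneSub z).re := by
  simpa [sqrtOneSub] using Complex.re_sqrt_nonneg _

/-- Conjugation turns the principal root's convention Im ≥ 0 on the imaginary axis into Im ≤ 0, the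
value reached on the cut from above. All later branch choices go through this criterion. -/
theorem sqrtOneSub_eq_of_sq {z w : ℂ} (h : w ^ 2 = 1 - z)
    (hw : 0 < w.re ∨ (w.re = 0 ∧ w.im ≤ 0)) : sqrtOneSub z = w := by
  have hz : (1 : ℂ) - (starRingEnd ℂ) z = (starRingEnd ℂ) w ^ 2 := by
    rw [← map_pow, h]
    simp
  rw [sqrtOneSub, hz, Complex.sqrt_of_pow_two (by simpa using hw), conj_conj]

theorem sqrtOneSub_eq_sqrt {z : ℂ} (hz : z ∈ cutPlane) : sqrtOneSub z = Complex.sqrt (1 - z) :=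
  sqrtOneSub_eq_of_sq (Complex.sqrt_pow_two _)
    (Or.inl (Complex.re_sqrt_pos (one_sub_mem_slitPlane hz)))

theorem re_sqrtOneSub_pos {z : ℂ} (hz : z ∈ cutPlane) : 0 < (sqrtOneSub z).re := by
  rw [sqrtOneSub_eq_sqrt hz]
  exact Complex.re_sqrt_pos (one_sub_mem_slitPlane hz)

theorem sqrtOneSub_zero : sqrtOneSub 0 = 1 := by simp [sqrtOneSub]

theorem sqrtOneSub_one : sqrtOneSub 1 = 0 := by simp [sqrtOneSub]

theorem differentiableOn_sqrtOneSub : DifferentiableOn ℂ sqrtOneSub cutPlane := by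
  have h : DifferentiableOn ℂ (fun z : ℂ => Complex.sqrt (1 - z)) cutPlane := fun z hz =>
    ((differentiableAt_sqrt (one_sub_mem_slitPlane hz)).comp z
      ((differentiableAt_id).const_sub 1)).differentiableWithinAt
  exact h.congr fun z hz => sqrtOneSub_eq_sqrt hz

theorem continuousAt_sqrtOneSub_one : ContinuousAt sqrtOneSub 1 := by
  have h : ContinuousAt Complex.sqrt (1 - (starRingEnd ℂ) 1) := continuousAt_sqrt (by simp)
  exact continuous_conj.continuousAt.comp
    (ContinuousAt.comp (f := fun z : ℂ => 1 - (starRingEnd ℂ) z) h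
      (continuous_const.sub continuous_conj).continuousAt)

/-- The principal logarithm is continuous on the negative axis from the closed upper half plane, and
z ↦ 1 - conj z sends the upper half plane to itself. -/
theorem tendsto_sqrtOneSub {t : ℝ} (ht : 1 < t) :
    Tendsto sqrtOneSub (𝓝[{z : ℂ | 0 < z.im}] (t : ℂ)) (𝓝 (sqrtOneSub t)) := by
  have hlog := continuousWithinAt_log_of_re_neg_of_im_zero (z := 1 - (starRingEnd ℂ) (t : ℂ))
    (by simpa using ht) (by simp)
  have hmap : Tendsto (fun z : ℂ => 1 - (starRingEnd ℂ) z) (𝓝[{z : ℂ | 0 < z.im}] (t : ℂ))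
      (𝓝[{z : ℂ | 0 ≤ z.im}] (1 - (starRingEnd ℂ) (t : ℂ))) := by
    refine tendsto_nhdsWithin_iff.2 ⟨?_, ?_⟩
    · exact ((continuous_const.sub continuous_conj).tendsto _).mono_left nhdsWithin_le_nhds
    · filter_upwards [self_mem_nhdsWithin] with z hz
      have hz' : 0 < z.im := hz
      simpa using hz'.le
  have hne : ∀ {z : ℂ}, z ≠ 1 → 1 - (starRingEnd ℂ) z ≠ 0 := by
    intro z hz h
    refine hz ?_
    have := congrArg (starRingEnd ℂ) h
    simp only [map_sub, map_one, conj_conj, map_zero] at this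
    linear_combination -this
  have heq : ∀ {z : ℂ}, z ≠ 1 →
      (starRingEnd ℂ) (exp (log (1 - (starRingEnd ℂ) z) / 2)) = sqrtOneSub z := by
    intro z hz
    rw [sqrtOneSub, sqrt_eq_exp (hne hz)]
  have hcomp := (continuous_conj.tendsto _).comp ((Complex.continuous_exp.tendsto _).comp
    ((hlog.tendsto.comp hmap).div_const 2))
  rw [heq (by exact_mod_cast ht.ne')] at hcomp
  refine hcomp.congr' ?_
  filter_upwards [self_mem_nhdsWithin] with z hz
  refine heq fun h => ?_
  have hz' : 0 < z.im := hz
  simp [h] at hz'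

/-! ### Continuation of the hypergeometric functions -/

/-- Analytic continuation of `F(1/2, 1/2, 1; ·)` to `ℂ ∖ [1, ∞)` by Landen's transformation. -/
noncomputable def halfExt (u : ℂ) : ℂ :=
  (1 + (1 - sqrtOneSub u) / (1 + sqrtOneSub u))
    * hypDiag (1 / 2) (((1 - sqrtOneSub u) / (1 + sqrtOneSub u)) ^ 2)

theorem norm_cayley_lt_one {r : ℂ} (hr : 0 < r.re) : ‖(1 - r) / (1 + r)‖ < 1 := by
  have hne : 1 + r ≠ 0 := fun h => by
    have := congrArg re h
    simp at this
    linarith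
  rw [norm_div, div_lt_one (norm_pos_iff.2 hne)]
  refine lt_of_pow_lt_pow_left₀ 2 (norm_nonneg _) ?_
  rw [← normSq_eq_norm_sq, ← normSq_eq_norm_sq, normSq_apply, normSq_apply]
  simp only [sub_re, one_re, sub_im, one_im, add_re, add_im]
  nlinarith

theorem one_add_ne_zero_of_re_pos {r : ℂ} (hr : 0 < r.re) : 1 + r ≠ 0 := fun h => by
  have := congrArg re h
  simp at this
  linarith

theorem differentiableOn_hypDiag {a : ℂ} (ha : 0 < a.re) :
    DifferentiableOn ℂ (hypDiag a) (Metric.ball 0 1) := fun z hz =>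
  (hypDiag_hasDerivAt ha (by simpa using hz)).1.differentiableAt.differentiableWithinAt

theorem differentiableOn_halfExt : DifferentiableOn ℂ halfExt cutPlane := by
  have hx : DifferentiableOn ℂ (fun u => (1 - sqrtOneSub u) / (1 + sqrtOneSub u)) cutPlane :=
    (differentiableOn_sqrtOneSub.const_sub 1).div (differentiableOn_sqrtOneSub.const_add 1)
      fun u hu => one_add_ne_zero_of_re_pos (re_sqrtOneSub_pos hu)
  refine (hx.const_add 1).mul ((differentiableOn_hypDiag (a := 1 / 2) (by norm_num)).comp
    (hx.pow 2) fun u hu => ?_)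
  have := norm_cayley_lt_one (re_sqrtOneSub_pos hu)
  simpa using pow_lt_one₀ (norm_nonneg _) this two_ne_zero

theorem eqOn_ball_of_eventuallyEq {f g : ℂ → ℂ} (hf : DifferentiableOn ℂ f (Metric.ball 0 1))
    (hg : DifferentiableOn ℂ g (Metric.ball 0 1)) (h : f =ᶠ[𝓝 0] g) {z : ℂ} (hz : ‖z‖ < 1) :
    f z = g z :=
  (hf.analyticOnNhd Metric.isOpen_ball).eqOn_of_preconnected_of_eventuallyEq
    (hg.analyticOnNhd Metric.isOpen_ball) (convex_ball (0 : ℂ) 1).isPreconnected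
    (Metric.mem_ball_self one_pos) h (by simpa using hz)

theorem ball_subset_cutPlane : Metric.ball (0 : ℂ) 1 ⊆ cutPlane := fun z hz =>
  mem_cutPlane_of_norm_lt_one (by simpa using hz)

theorem continuousAt_sqrtOneSub {z : ℂ} (hz : z ∈ cutPlane) : ContinuousAt sqrtOneSub z :=
  (differentiableOn_sqrtOneSub.differentiableAt (isOpen_cutPlane.mem_nhds hz)).continuousAt

theorem continuousAt_halfExt {z : ℂ} (hz : z ∈ cutPlane) : ContinuousAt halfExt z :=
  (differentiableOn_halfExt.differentiableAt (isOpen_cutPlane.mem_nhds hz)).continuousAt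

theorem zero_mem_cutPlane : (0 : ℂ) ∈ cutPlane := mem_cutPlane_of_norm_lt_one (by simp)

/-- For x = (1-r)/(1+r) with r² = 1-u one has 4x/(1+x)² = u, so near 0 this is Landen's
transformation; the identity theorem extends it to the disc. -/
theorem halfExt_eq_hypDiag {u : ℂ} (hu : ‖u‖ < 1) : halfExt u = hypDiag (1 / 2) u := by
  refine eqOn_ball_of_eventuallyEq (differentiableOn_halfExt.mono ball_subset_cutPlane)
    (differentiableOn_hypDiag (by norm_num)) ?_ hu
  have hx : Tendsto (fun u => (1 - sqrtOneSub u) / (1 + sqrtOneSub u)) (𝓝 0) (𝓝 0) := by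
    have hs := continuousAt_sqrtOneSub zero_mem_cutPlane
    have := (hs.tendsto.const_sub 1).div (hs.tendsto.const_add 1) (by simp [sqrtOneSub_zero])
    simp only [sqrtOneSub_zero, sub_self, zero_div] at this
    exact this
  filter_upwards [hx.eventually hypDiag_half_landen, isOpen_cutPlane.mem_nhds zero_mem_cutPlane]
    with u hu hcut
  have hr := one_add_ne_zero_of_re_pos (re_sqrtOneSub_pos hcut)
  have hsq := sqrtOneSub_sq u
  have h1 : 1 + (1 - sqrtOneSub u) / (1 + sqrtOneSub u) = 2 / (1 + sqrtOneSub u) := by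
    field_simp
    ring
  have h2 : 4 * ((1 - sqrtOneSub u) / (1 + sqrtOneSub u))
      / (1 + (1 - sqrtOneSub u) / (1 + sqrtOneSub u)) ^ 2 = u := by
    rw [h1]
    field_simp
    linear_combination -4 * hsq
  rw [halfExt, ← hu, h2, h1]
  field_simp

theorem halfExt_zero : halfExt 0 = 1 := by
  rw [halfExt_eq_hypDiag (by simp), hypDiag_zero]

/-- The extension of `F(1/4, 1/4, 1; ·)` to `ℂ`. -/
noncomputable def quarterExt (z : ℂ) : ℂ := halfExt ((1 - sqrtOneSub z) / 2)

/-- The real part is at most 1/2 for every z, including 1 and the cut, so `quarterExt` is continuous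
wherever the square root is. -/
theorem one_sub_sqrtOneSub_div_two_mem_cutPlane (z : ℂ) : (1 - sqrtOneSub z) / 2 ∈ cutPlane := by
  refine mem_cutPlane_of_re_lt_one ?_
  have := re_sqrtOneSub_nonneg z
  simp only [div_ofNat_re, sub_re, one_re]
  linarith

theorem differentiableOn_quarterExt : DifferentiableOn ℂ quarterExt cutPlane :=
  differentiableOn_halfExt.comp ((differentiableOn_sqrtOneSub.const_sub 1).div_const 2)
    fun z _ => one_sub_sqrtOneSub_div_two_mem_cutPlane z

theorem tendsto_quarterExt {l : Filter ℂ} {z : ℂ}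
    (h : Tendsto sqrtOneSub l (𝓝 (sqrtOneSub z))) : Tendsto quarterExt l (𝓝 (quarterExt z)) :=
  (continuousAt_halfExt (one_sub_sqrtOneSub_div_two_mem_cutPlane z)).tendsto.comp
    ((h.const_sub 1).div_const 2)

theorem tendsto_one_sub_sqrtOneSub_div_two :
    Tendsto (fun z => (1 - sqrtOneSub z) / 2) (𝓝 0) (𝓝 0) := by
  have hs := continuousAt_sqrtOneSub zero_mem_cutPlane
  have := (hs.const_sub 1).div_const 2
  simpa [ContinuousAt, sqrtOneSub_zero] using this

theorem four_mul_one_sub_sqrtOneSub_div_two (z : ℂ) :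
    4 * ((1 - sqrtOneSub z) / 2) * (1 - (1 - sqrtOneSub z) / 2) = z := by
  linear_combination -sqrtOneSub_sq z

theorem isSingleValued_quarterExt :
    IsSingleValuedHypergeometric (1 / 4) (1 / 4) 1 quarterExt where
  differentiableOn := differentiableOn_quarterExt
  eq_series z hz := by
    refine eqOn_ball_of_eventuallyEq (differentiableOn_quarterExt.mono ball_subset_cutPlane)
      (differentiableOn_hypDiag (a := 1 / 4) (by norm_num)) ?_ hz
    have ht := tendsto_one_sub_sqrtOneSub_div_two
    filter_upwards [ht.eventually hypDiag_quarter_quadratic,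
      ht.eventually (eventually_norm_lt_one (φ := fun z => z) continuousAt_id rfl)] with w hw hw1
    rw [quarterExt, halfExt_eq_hypDiag hw1, ← hw, four_mul_one_sub_sqrtOneSub_div_two]
  tendsto_of_one_lt t ht := tendsto_quarterExt (tendsto_sqrtOneSub ht)

/-- With u = (1-√(1-z))/2 the factor 1-2u of the second quadratic transformation is √(1-z), which
vanishes only at z = 1. -/
theorem isSingleValued_quarterExt_div :
    IsSingleValuedHypergeometric (3 / 4) (3 / 4) 1 fun z => quarterExt z / sqrtOneSub z := by
  have hne : ∀ {z : ℂ}, z ≠ 1 → sqrtOneSub z ≠ 0 := fun {z} hz h => hz <| by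
    have := sqrtOneSub_sq z
    rw [h] at this
    linear_combination this
  have hne1 : ∀ {z : ℂ}, z ∈ cutPlane → z ≠ 1 := fun {z} hz h => by
    have := mem_cutPlane.1 hz
    simp [h] at this
  have hd : DifferentiableOn ℂ (fun z => quarterExt z / sqrtOneSub z) cutPlane :=
    differentiableOn_quarterExt.div differentiableOn_sqrtOneSub fun z hz => hne (hne1 hz)
  refine ⟨hd, fun z hz => ?_, fun t ht => ?_⟩
  · refine eqOn_ball_of_eventuallyEq (hd.mono ball_subset_cutPlane)
      (differentiableOn_hypDiag (a := 3 / 4) (by norm_num)) ?_ hz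
    have ht := tendsto_one_sub_sqrtOneSub_div_two
    filter_upwards [ht.eventually hypDiag_three_quarters_quadratic,
      ht.eventually (eventually_norm_lt_one (φ := fun z => z) continuousAt_id rfl),
      isOpen_cutPlane.mem_nhds zero_mem_cutPlane] with w hw hw1 hcut
    rw [quarterExt, halfExt_eq_hypDiag hw1, ← hw, four_mul_one_sub_sqrtOneSub_div_two,
      show 1 - 2 * ((1 - sqrtOneSub w) / 2) = sqrtOneSub w by ring,
      mul_div_cancel_left₀ _ (hne (hne1 hcut))]
  · exact (tendsto_quarterExt (tendsto_sqrtOneSub ht)).div (tendsto_sqrtOneSub ht)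
      (hne (by exact_mod_cast ht.ne'))

theorem isSingleValued_hypergeometricF {a b c : ℂ} {f : ℂ → ℂ}
    (hf : IsSingleValuedHypergeometric a b c f) :
    IsSingleValuedHypergeometric a b c (hypergeometricF a b c) := by
  have h : ∃ f : ℂ → ℂ, IsSingleValuedHypergeometric a b c f := ⟨f, hf⟩
  rw [hypergeometricF, dif_pos h]
  exact Classical.choose_spec h

theorem hypergeometricF_eq {a b c : ℂ} {f : ℂ → ℂ} (hf : IsSingleValuedHypergeometric a b c f)
    {z : ℂ} (hz : z ≠ 1) : hypergeometricF a b c z = f z :=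
  (isSingleValued_hypergeometricF hf).eqOn hf hz

/-! ### Positivity of F(1/2, 1/2, 1; ·) at 1/2 -/

theorem exists_pos_coefficient_half (n : ℕ) : ∃ c : ℝ, 0 < c ∧
    ordinaryHypergeometricCoefficient (1 / 2 : ℂ) (1 / 2) 1 n = c := by
  induction n with
  | zero => exact ⟨1, one_pos, by simp [ordinaryHypergeometricCoefficient]⟩
  | succ n ih =>
    obtain ⟨c, hc, h⟩ := ih
    have hn : (n : ℂ) + 1 ≠ 0 := by exact_mod_cast Nat.succ_ne_zero n
    refine ⟨(1 / 2 + n) ^ 2 / (n + 1) ^ 2 * c, by positivity, ?_⟩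
    have := ordinaryHypergeometricCoefficient_succ (1 / 2) n
    rw [h] at this
    push_cast
    rw [div_mul_eq_mul_div, eq_div_iff (pow_ne_zero 2 hn)]
    linear_combination this

theorem exists_hasSum_hypDiag_half : ∃ c : ℕ → ℝ, (∀ n, 0 < c n) ∧
    ∀ z : ℂ, ‖z‖ < 1 → HasSum (fun n => (c n : ℂ) * z ^ n) (hypDiag (1 / 2) z) := by
  choose c hc h using exists_pos_coefficient_half
  refine ⟨c, hc, fun z hz => ?_⟩
  have hk := natCast_ne_neg_of_re_pos (a := 1 / 2) (by norm_num)
  have hk1 := natCast_ne_neg_of_re_pos (a := 1) (by norm_num)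
  have := hasSum_ordinaryHypergeometric (fun k => ⟨hk k, hk k, hk1 k⟩) hz
  simp only [h] at this
  exact this

/-- A power series with positive coefficients is positive at a point of `[0, 1)`. -/
theorem hasSum_pos_of_coeff_pos {c : ℕ → ℝ} (hc : ∀ n, 0 < c n) {t : ℝ} (ht : 0 ≤ t) {s : ℂ}
    (h : HasSum (fun n => (c n : ℂ) * (t : ℂ) ^ n) s) : s.im = 0 ∧ 0 < s.re := by
  have hre : HasSum (fun n => c n * t ^ n) s.re := by
    have := hasSum_re h
    refine this.congr_fun fun n => ?_
    rw [← ofReal_pow, ← ofReal_mul, ofReal_re]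
  have him : HasSum (fun _ : ℕ => (0 : ℝ)) s.im := by
    have := hasSum_im h
    refine this.congr_fun fun n => ?_
    rw [← ofReal_pow, ← ofReal_mul, ofReal_im]
  refine ⟨him.unique hasSum_zero, ?_⟩
  have := le_hasSum hre 0 fun n _ => mul_nonneg (hc n).le (pow_nonneg ht n)
  simp only [pow_zero, mul_one] at this
  exact (hc 0).trans_le this

theorem hypDiag_half_at_half : (hypDiag (1 / 2) (1 / 2)).im = 0 ∧ 0 < (hypDiag (1 / 2) (1 / 2)).re ∧
    0 < (deriv (hypDiag (1 / 2)) (1 / 2)).re := by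
  obtain ⟨c, hc, h⟩ := exists_hasSum_hypDiag_half
  have hz : ‖(1 / 2 : ℂ)‖ < 1 := by norm_num
  have h1 := (hasSum_deriv_of_hasSum h).2 (1 / 2) hz
  have ht : ((1 / 2 : ℝ) : ℂ) = 1 / 2 := by push_cast; rfl
  obtain ⟨h2, h3⟩ := hasSum_pos_of_coeff_pos hc (t := 1 / 2) (by norm_num)
    (by rw [ht]; exact h _ hz)
  refine ⟨h2, h3, (hasSum_pos_of_coeff_pos (c := fun n : ℕ => ((n : ℝ) + 1) * c (n + 1))
    (fun n => mul_pos (by positivity) (hc _)) (t := 1 / 2) (by norm_num) ?_).2⟩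
  rw [ht]
  simpa using h1

/-- Near `1/2`, on the line `Re u = 1/2`, the imaginary parts of `F(1/2, 1/2, 1; u)` and of `u`
have the same sign. -/
theorem eventually_im_hypDiag_half_div_pos :
    ∀ᶠ y : ℝ in 𝓝[≠] 0, 0 < (hypDiag (1 / 2) (1 / 2 + y * I)).im / y := by
  obtain ⟨h1, -, h3⟩ := hypDiag_half_at_half
  have hG := (hypDiag_hasDerivAt (a := 1 / 2) (z := 1 / 2) (by norm_num) (by norm_num)).1
  have hline : HasDerivAt (fun y : ℝ => (1 / 2 : ℂ) + y * I) I 0 := by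
    simpa using ((ofRealCLM.hasDerivAt (x := (0 : ℝ))).mul_const I).const_add (1 / 2 : ℂ)
  have hcomp : HasDerivAt (fun y : ℝ => hypDiag (1 / 2) ((1 / 2 : ℂ) + y * I))
      (deriv (hypDiag (1 / 2)) (1 / 2) * I) 0 :=
    HasDerivAt.comp (𝕜 := ℝ) (0 : ℝ) (h₂ := hypDiag (1 / 2)) (by simpa using hG) hline
  -- Along the vertical line the derivative of Im G is Im(iG'(1/2)) = Re G'(1/2) > 0.
  have him : HasDerivAt (fun y : ℝ => (hypDiag (1 / 2) ((1 / 2 : ℂ) + y * I)).im)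
      (deriv (hypDiag (1 / 2)) (1 / 2)).re 0 := by
    have := imCLM.hasFDerivAt.comp_hasDerivAt (0 : ℝ) hcomp
    simp only [imCLM_apply, mul_I_im] at this
    exact this
  have hs := hasDerivAt_iff_tendsto_slope.1 him
  filter_upwards [hs.eventually (lt_mem_nhds h3)] with y hy
  have h0 : (hypDiag (1 / 2) (1 / 2 + ((0 : ℝ) : ℂ) * I)).im = 0 := by simpa using h1
  simpa only [slope_def_field, h0, sub_zero] using hy

/-! ### Theta constants: translation, reflection, inversion -/

theorem thetaConst_zero_zero (τ : ℂ) : thetaConst 0 0 τ = jacobiTheta₂ 0 τ := by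
  refine tsum_congr fun n => ?_
  simp only [jacobiTheta₂_term]
  congr 1
  push_cast
  ring

theorem thetaConst_zero_one (τ : ℂ) : thetaConst 0 1 τ = jacobiTheta₂ (1 / 2) τ := by
  refine tsum_congr fun n => ?_
  simp only [jacobiTheta₂_term]
  congr 1
  push_cast
  ring

theorem thetaConst_one_zero (τ : ℂ) :
    thetaConst 1 0 τ = exp (Real.pi * I * τ / 4) * jacobiTheta₂ (τ / 2) τ := by
  rw [thetaConst, jacobiTheta₂, ← tsum_mul_left]
  refine tsum_congr fun n => ?_
  rw [jacobiTheta₂_term, ← exp_add]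
  congr 1
  push_cast
  ring

/-- Since n² ≡ n mod 2, the shift multiplies the n-th term by (-1)ⁿ. -/
theorem thetaConst_zero_zero_add_one (τ : ℂ) : thetaConst 0 0 (τ + 1) = thetaConst 0 1 τ := by
  refine tsum_congr fun n => ?_
  obtain ⟨m, hm⟩ : ∃ m : ℤ, n * n - n = 2 * m := by
    obtain ⟨k, hk⟩ := Int.even_mul_pred_self n
    exact ⟨k, by linarith [hk, mul_sub n n 1]⟩
  have hm' : (n : ℂ) * n - n = 2 * m := by exact_mod_cast hm
  rw [exp_eq_exp_iff_exists_int]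
  refine ⟨m, ?_⟩
  push_cast
  linear_combination (Real.pi * I : ℂ) * hm'

theorem thetaConst_zero_one_add_one (τ : ℂ) : thetaConst 0 1 (τ + 1) = thetaConst 0 0 τ := by
  rw [← thetaConst_zero_zero_add_one, add_assoc, one_add_one_eq_two, thetaConst_zero_zero,
    jacobiTheta₂_add_right, thetaConst_zero_zero]

theorem thetaConst_one_zero_add_one (τ : ℂ) :
    thetaConst 1 0 (τ + 1) = exp (Real.pi * I / 4) * thetaConst 1 0 τ := by
  rw [thetaConst, thetaConst, ← tsum_mul_left]
  refine tsum_congr fun n => ?_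
  obtain ⟨m, hm⟩ : ∃ m : ℤ, n * (n + 1) = 2 * m := by
    obtain ⟨k, hk⟩ := Int.even_mul_succ_self n
    exact ⟨k, by linarith [hk]⟩
  have hm' : (n : ℂ) * (n + 1) = 2 * m := by exact_mod_cast hm
  rw [← exp_add, exp_eq_exp_iff_exists_int]
  refine ⟨m, ?_⟩
  push_cast
  linear_combination (Real.pi * I : ℂ) * hm'

theorem thetaConst_one_zero_add_one_pow_four (τ : ℂ) :
    thetaConst 1 0 (τ + 1) ^ 4 = -thetaConst 1 0 τ ^ 4 := by
  rw [thetaConst_one_zero_add_one, mul_pow, ← exp_nat_mul,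
    show ((4 : ℕ) : ℂ) * (Real.pi * I / 4) = Real.pi * I by push_cast; ring, exp_pi_mul_I]
  ring

theorem differentiableAt_thetaConst_zero_zero {τ : ℂ} (hτ : 0 < τ.im) :
    DifferentiableAt ℂ (thetaConst 0 0) τ := by
  rw [show thetaConst 0 0 = jacobiTheta₂ 0 from funext thetaConst_zero_zero]
  exact differentiableAt_jacobiTheta₂_snd 0 hτ

theorem differentiableAt_thetaConst_zero_one {τ : ℂ} (hτ : 0 < τ.im) :
    DifferentiableAt ℂ (thetaConst 0 1) τ := by
  rw [show thetaConst 0 1 = jacobiTheta₂ (1 / 2) from funext thetaConst_zero_one]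
  exact differentiableAt_jacobiTheta₂_snd _ hτ

open scoped ComplexConjugate in
theorem thetaConst_zero_zero_conj (τ : ℂ) :
    thetaConst 0 0 (-conj τ) = conj (thetaConst 0 0 τ) := by
  rw [thetaConst_zero_zero, thetaConst_zero_zero, jacobiTheta₂_conj, map_zero]

open scoped ComplexConjugate in
theorem thetaConst_zero_one_conj (τ : ℂ) :
    thetaConst 0 1 (-conj τ) = conj (thetaConst 0 1 τ) := by
  rw [thetaConst_zero_one, thetaConst_zero_one, jacobiTheta₂_conj]
  simp [conj_ofNat]

open scoped ComplexConjugate in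
theorem thetaConst_one_zero_conj (τ : ℂ) :
    thetaConst 1 0 (-conj τ) = conj (thetaConst 1 0 τ) := by
  rw [thetaConst_one_zero, thetaConst_one_zero, map_mul, jacobiTheta₂_conj, ← exp_conj,
    show -conj τ / 2 = -conj (τ / 2) by simp [neg_div, conj_ofNat], jacobiTheta₂_neg_left]
  simp [conj_ofNat]

theorem neg_I_mul_ne_zero {τ : ℂ} (hτ : 0 < τ.im) : -I * τ ≠ 0 :=
  mul_ne_zero (neg_ne_zero.2 I_ne_zero) fun h => by simp [h] at hτ

theorem sqrt_sq_of_cpow_half (z : ℂ) : (z ^ (1 / 2 : ℂ)) ^ 2 = z := by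
  rw [one_div]
  exact cpow_ofNat_inv_pow z 2

/-- Squaring removes the branch of (-iτ)^(1/2) from the functional equation. -/
theorem thetaConst_zero_zero_neg_inv_sq {τ : ℂ} (hτ : 0 < τ.im) :
    thetaConst 0 0 (-1 / τ) ^ 2 = -I * τ * thetaConst 0 0 τ ^ 2 := by
  have h := jacobiTheta₂_functional_equation 0 τ
  simp only [zero_div, ne_eq, OfNat.ofNat_ne_zero, not_false_eq_true, zero_pow, mul_zero,
    exp_zero, mul_one] at h
  rw [thetaConst_zero_zero, thetaConst_zero_zero, h, mul_pow, div_pow, sqrt_sq_of_cpow_half]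
  have := neg_I_mul_ne_zero hτ
  rw [one_pow, ← mul_assoc, mul_one_div_cancel this, one_mul]

theorem thetaConst_one_zero_neg_inv_sq {τ : ℂ} (hτ : 0 < τ.im) :
    thetaConst 1 0 (-1 / τ) ^ 2 = -I * τ * thetaConst 0 1 τ ^ 2 := by
  have hτ0 : τ ≠ 0 := fun h => by simp [h] at hτ
  have h := jacobiTheta₂_functional_equation (1 / 2) τ
  rw [thetaConst_one_zero, thetaConst_zero_one, h, mul_pow, mul_pow, mul_pow, div_pow,
    sqrt_sq_of_cpow_half,
    show -1 / τ / 2 = -(1 / 2 / τ) by field_simp, jacobiTheta₂_neg_left,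
    show (Real.pi * I * (-1 / τ) / 4 : ℂ) = -Real.pi * I * (1 / 2) ^ 2 / τ by ring]
  have := neg_I_mul_ne_zero hτ
  rw [one_pow, ← mul_assoc, ← mul_assoc, mul_one_div_cancel this, one_mul]

/-! ### Doubling formulas and Jacobi's identity -/

theorem neg_one_zpow_eq_exp (n : ℤ) : ((-1 : ℂ)) ^ n = exp (Real.pi * I * n) := by
  rw [← exp_pi_mul_I, ← exp_int_mul]
  congr 1
  ring

theorem thetaConst_zero_zero_eq_tsum (τ : ℂ) :
    thetaConst 0 0 τ = ∑' n : ℤ, exp (Real.pi * I * n ^ 2 * τ) := by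
  refine tsum_congr fun n => ?_
  congr 1
  push_cast
  ring

theorem thetaConst_zero_one_eq_tsum (τ : ℂ) :
    thetaConst 0 1 τ = ∑' n : ℤ, (-1) ^ n * exp (Real.pi * I * n ^ 2 * τ) := by
  refine tsum_congr fun n => ?_
  rw [neg_one_zpow_eq_exp, ← exp_add]
  congr 1
  push_cast
  ring

theorem thetaConst_one_zero_eq_tsum (τ : ℂ) :
    thetaConst 1 0 τ = ∑' n : ℤ, exp (Real.pi * I * (n + 1 / 2) ^ 2 * τ) := by
  refine tsum_congr fun n => ?_
  congr 1
  push_cast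
  ring

theorem summable_norm_exp_sq {τ : ℂ} (hτ : 0 < τ.im) :
    Summable fun n : ℤ => ‖exp (Real.pi * I * n ^ 2 * τ)‖ := by
  have := ((summable_jacobiTheta₂_term_iff 0 τ).2 hτ).norm
  refine this.congr fun n => ?_
  simp [jacobiTheta₂_term]

theorem summable_norm_neg_one_zpow_mul_exp_sq {τ : ℂ} (hτ : 0 < τ.im) :
    Summable fun n : ℤ => ‖(-1) ^ n * exp (Real.pi * I * n ^ 2 * τ)‖ := by
  refine (summable_norm_exp_sq hτ).congr fun n => ?_
  simp

theorem summable_norm_exp_half_sq {τ : ℂ} (hτ : 0 < τ.im) :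
    Summable fun n : ℤ => ‖exp (Real.pi * I * (n + 1 / 2) ^ 2 * τ)‖ := by
  have := (((summable_jacobiTheta₂_term_iff (τ / 2) τ).2 hτ).mul_left
    (exp (Real.pi * I * τ / 4))).norm
  refine this.congr fun n => ?_
  rw [jacobiTheta₂_term, ← exp_add]
  congr 2
  ring

/-- Sum over pairs of integers with even sum. -/
theorem tsum_eq_tsum_add_sub {f : ℤ × ℤ → ℂ} (hf : ∀ m n : ℤ, Odd (m + n) → f (m, n) = 0) :
    ∑' p, f p = ∑' p : ℤ × ℤ, f (p.1 + p.2, p.1 - p.2) := by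
  have hinj : Function.Injective fun p : ℤ × ℤ => (p.1 + p.2, p.1 - p.2) := by
    rintro ⟨a, b⟩ ⟨c, d⟩ h
    simp only [Prod.mk.injEq] at h ⊢
    omega
  refine (hinj.tsum_eq (f := f) ?_).symm
  rintro ⟨m, n⟩ hmn
  have h : ¬ Odd (m + n) := fun h => hmn (hf m n h)
  obtain ⟨k, hk⟩ := Int.not_odd_iff_even.1 h
  exact ⟨(k, m - k), by simp only [Prod.mk.injEq]; omega⟩

/-- Sum over pairs of integers with odd sum. -/
theorem tsum_eq_tsum_add_one_sub {f : ℤ × ℤ → ℂ} (hf : ∀ m n : ℤ, Even (m + n) → f (m, n) = 0) :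
    ∑' p, f p = ∑' p : ℤ × ℤ, f (p.1 + p.2 + 1, p.1 - p.2) := by
  have hinj : Function.Injective fun p : ℤ × ℤ => (p.1 + p.2 + 1, p.1 - p.2) := by
    rintro ⟨a, b⟩ ⟨c, d⟩ h
    simp only [Prod.mk.injEq] at h ⊢
    omega
  refine (hinj.tsum_eq (f := f) ?_).symm
  rintro ⟨m, n⟩ hmn
  have h : ¬ Even (m + n) := fun h => hmn (hf m n h)
  obtain ⟨k, hk⟩ := Int.not_even_iff_odd.1 h
  exact ⟨(k, m - k - 1), by simp only [Prod.mk.injEq]; omega⟩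

theorem neg_one_zpow_mul_neg_one_zpow (m n : ℤ) : (-1 : ℂ) ^ m * (-1) ^ n = (-1) ^ (m + n) :=
  (zpow_add₀ (by norm_num) m n).symm

/-- Expand the products as sums over (m, n) and keep one parity of m+n. Setting (m, n) = (a+b, a-b)
gives m²+n² = 2(a²+b²); (a+b+1, a-b) gives 2((a+1/2)²+(b+1/2)²). -/
theorem thetaConst_two_mul {τ : ℂ} (hτ : 0 < τ.im) :
    thetaConst 0 0 τ ^ 2 + thetaConst 0 1 τ ^ 2 = 2 * thetaConst 0 0 (2 * τ) ^ 2 ∧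
    thetaConst 0 0 τ ^ 2 - thetaConst 0 1 τ ^ 2 = 2 * thetaConst 1 0 (2 * τ) ^ 2 ∧
    thetaConst 0 0 τ * thetaConst 0 1 τ = thetaConst 0 1 (2 * τ) ^ 2 := by
  have hτ2 : 0 < (2 * τ).im := by simpa using hτ
  have s0 := summable_norm_exp_sq hτ
  have s1 := summable_norm_neg_one_zpow_mul_exp_sq hτ
  have e00 := tsum_mul_tsum_of_summable_norm s0 s0
  have e01 := tsum_mul_tsum_of_summable_norm s0 s1
  have e10 := tsum_mul_tsum_of_summable_norm s1 s0
  have e11 := tsum_mul_tsum_of_summable_norm s1 s1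
  have m00 := summable_mul_of_summable_norm s0 s0
  have m01 := summable_mul_of_summable_norm s0 s1
  have m10 := summable_mul_of_summable_norm s1 s0
  have m11 := summable_mul_of_summable_norm s1 s1
  rw [← thetaConst_zero_zero_eq_tsum] at e00
  rw [← thetaConst_zero_zero_eq_tsum, ← thetaConst_zero_one_eq_tsum] at e01 e10
  rw [← thetaConst_zero_one_eq_tsum] at e11
  have hodd : ∀ {k : ℤ}, Odd k → (-1 : ℂ) ^ k = -1 := fun h => h.neg_one_zpow
  have heven : ∀ {k : ℤ}, Even k → (-1 : ℂ) ^ k = 1 := fun h => h.neg_one_zpow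
  refine ⟨?_, ?_, ?_⟩
  · rw [sq, sq, e00, e11, ← m00.tsum_add m11, tsum_eq_tsum_add_sub, sq (thetaConst 0 0 (2 * τ)),
      thetaConst_zero_zero_eq_tsum, tsum_mul_tsum_of_summable_norm (summable_norm_exp_sq hτ2)
        (summable_norm_exp_sq hτ2), ← tsum_mul_left]
    · refine tsum_congr fun p => ?_
      rw [mul_mul_mul_comm, neg_one_zpow_mul_neg_one_zpow, heven ⟨p.1, by ring⟩, ← exp_add,
        ← exp_add, one_mul, ← two_mul]
      congr 2
      push_cast
      ring
    · intro m n h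
      rw [mul_mul_mul_comm, neg_one_zpow_mul_neg_one_zpow, hodd h]
      ring
  · rw [sq, sq, e00, e11, ← m00.tsum_sub m11, tsum_eq_tsum_add_one_sub,
      sq (thetaConst 1 0 (2 * τ)), thetaConst_one_zero_eq_tsum,
      tsum_mul_tsum_of_summable_norm (summable_norm_exp_half_sq hτ2)
        (summable_norm_exp_half_sq hτ2), ← tsum_mul_left]
    · refine tsum_congr fun p => ?_
      rw [mul_mul_mul_comm, neg_one_zpow_mul_neg_one_zpow, hodd ⟨p.1, by ring⟩, ← exp_add,
        ← exp_add, neg_one_mul, sub_neg_eq_add, ← two_mul]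
      congr 2
      push_cast
      ring
    · intro m n h
      rw [mul_mul_mul_comm, neg_one_zpow_mul_neg_one_zpow, heven h]
      ring
  -- Adding the product in both orders cancels the terms with m+n odd, since then (-1)^m + (-1)^n =
  -- 0.
  · have h2 : 2 * (thetaConst 0 0 τ * thetaConst 0 1 τ) = 2 * thetaConst 0 1 (2 * τ) ^ 2 := by
      rw [two_mul]
      nth_rw 2 [mul_comm]
      rw [e01, e10, ← m01.tsum_add m10, tsum_eq_tsum_add_sub, sq (thetaConst 0 1 (2 * τ)),
        thetaConst_zero_one_eq_tsum, tsum_mul_tsum_of_summable_norm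
          (summable_norm_neg_one_zpow_mul_exp_sq hτ2)
          (summable_norm_neg_one_zpow_mul_exp_sq hτ2), ← tsum_mul_left]
      · refine tsum_congr fun p => ?_
        have hs : (-1 : ℂ) ^ (p.1 - p.2) = (-1) ^ (p.1 + p.2) := by
          rw [show p.1 + p.2 = (p.1 - p.2) + 2 * p.2 by ring, zpow_add₀ (by norm_num),
            heven (even_two_mul p.2), mul_one]
        have hexp : exp (Real.pi * I * ((p.1 + p.2 : ℤ) : ℂ) ^ 2 * τ)
            * exp (Real.pi * I * ((p.1 - p.2 : ℤ) : ℂ) ^ 2 * τ)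
            = exp (Real.pi * I * (p.1 : ℂ) ^ 2 * (2 * τ))
              * exp (Real.pi * I * (p.2 : ℂ) ^ 2 * (2 * τ)) := by
          rw [← exp_add, ← exp_add]
          congr 1
          push_cast
          ring
        dsimp only
        rw [hs]
        linear_combination 2 * (-1) ^ (p.1 + p.2) * hexp
          - 2 * exp (Real.pi * I * (p.1 : ℂ) ^ 2 * (2 * τ))
            * exp (Real.pi * I * (p.2 : ℂ) ^ 2 * (2 * τ)) * neg_one_zpow_mul_neg_one_zpow p.1 p.2
      · intro m n h
        have hs : (-1 : ℂ) ^ m + (-1) ^ n = 0 := by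
          have h1 := neg_one_zpow_mul_neg_one_zpow m n
          rw [hodd h] at h1
          rcases Int.even_or_odd m with hm | hm
          · rw [heven hm] at h1 ⊢
            linear_combination h1
          · rw [hodd hm] at h1 ⊢
            linear_combination -h1
        linear_combination exp (Real.pi * I * m ^ 2 * τ) * exp (Real.pi * I * n ^ 2 * τ) * hs
    exact mul_left_cancel₀ two_ne_zero h2

/-- Jacobi's identity. -/
theorem thetaConst_jacobi {τ : ℂ} (hτ : 0 < τ.im) :
    thetaConst 0 0 τ ^ 4 = thetaConst 0 1 τ ^ 4 + thetaConst 1 0 τ ^ 4 := by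
  obtain ⟨h1, h2, h3⟩ := thetaConst_two_mul (τ := τ / 2) (by simpa using hτ)
  rw [mul_div_cancel₀ _ (two_ne_zero' ℂ)] at h1 h2 h3
  have h4 : thetaConst 0 0 τ ^ 2 = (thetaConst 0 0 (τ / 2) ^ 2 + thetaConst 0 1 (τ / 2) ^ 2) / 2 := by
    rw [h1]; ring
  have h5 : thetaConst 1 0 τ ^ 2 = (thetaConst 0 0 (τ / 2) ^ 2 - thetaConst 0 1 (τ / 2) ^ 2) / 2 := by
    rw [h2]; ring
  have h6 : ∀ z : ℂ, z ^ 4 = (z ^ 2) ^ 2 := fun z => by ring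
  rw [h6, h6 (thetaConst 0 1 τ), h6 (thetaConst 1 0 τ), h4, h5, ← h3]
  ring

/-! ### Limits at i∞ and non-vanishing -/

theorem tendsto_thetaConst_zero_zero :
    Tendsto (thetaConst 0 0) (comap im atTop) (𝓝 1) := by
  have h1 := isBigO_at_im_infty_jacobiTheta_sub_one
  have h2 : Tendsto (fun τ : ℂ => Real.exp (-Real.pi * τ.im)) (comap im atTop) (𝓝 0) := by
    refine Real.tendsto_exp_atBot.comp ?_
    exact (tendsto_comap (f := im) (x := atTop)).const_mul_atTop_of_neg (by linarith [Real.pi_pos])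
  have h3 := (h1.trans_tendsto h2).add_const 1
  refine (by simpa using h3 : Tendsto jacobiTheta _ _).congr fun τ => ?_
  rw [thetaConst_zero_zero, jacobiTheta_eq_jacobiTheta₂]

theorem tendsto_thetaConst_zero_one :
    Tendsto (thetaConst 0 1) (comap im atTop) (𝓝 1) := by
  have h : Tendsto (fun τ : ℂ => τ + 1) (comap im atTop) (comap im atTop) := by
    refine tendsto_comap_iff.2 ?_
    exact tendsto_comap.congr fun τ => by simp
  exact (tendsto_thetaConst_zero_zero.comp h).congr fun τ => thetaConst_zero_zero_add_one τ

theorem tendsto_two_pow_mul {τ : ℂ} (hτ : 0 < τ.im) :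
    Tendsto (fun n : ℕ => 2 ^ n * τ) atTop (comap im atTop) := by
  refine tendsto_comap_iff.2 ?_
  have h : Tendsto (fun n : ℕ => (2 : ℝ) ^ n * τ.im) atTop atTop :=
    (tendsto_pow_atTop_atTop_of_one_lt one_lt_two).atTop_mul_const hτ
  refine h.congr fun n => ?_
  rw [Function.comp_apply, show (2 : ℂ) ^ n = (((2 : ℝ) ^ n : ℝ) : ℂ) by push_cast; rfl,
    im_ofReal_mul]

/-- By ϑ₀₁(2τ)² = ϑ₀₀(τ)ϑ₀₁(τ), a zero at τ propagates to every 2ⁿτ, against the limit 1 at i∞. -/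
theorem thetaConst_zero_one_ne_zero {τ : ℂ} (hτ : 0 < τ.im) : thetaConst 0 1 τ ≠ 0 := by
  intro h0
  have hn : ∀ n : ℕ, 0 < (2 ^ n * τ).im ∧ thetaConst 0 1 (2 ^ n * τ) = 0 := by
    intro n
    induction n with
    | zero => simpa using ⟨hτ, h0⟩
    | succ n ih =>
      obtain ⟨h1, h2⟩ := ih
      rw [pow_succ', mul_assoc]
      refine ⟨by simpa using h1, ?_⟩
      have h3 := (thetaConst_two_mul h1).2.2
      rw [h2, mul_zero] at h3
      exact pow_eq_zero_iff two_ne_zero |>.1 h3.symm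
  have h1 := tendsto_thetaConst_zero_one.comp (tendsto_two_pow_mul hτ)
  have h2 : Tendsto (fun _ : ℕ => (0 : ℂ)) atTop (𝓝 1) := h1.congr fun n => (hn n).2
  exact one_ne_zero (tendsto_nhds_unique h2 tendsto_const_nhds)

theorem thetaConst_zero_zero_ne_zero {τ : ℂ} (hτ : 0 < τ.im) : thetaConst 0 0 τ ≠ 0 := by
  have h := thetaConst_zero_one_ne_zero (τ := τ + 1) (by simpa using hτ)
  rwa [thetaConst_zero_one_add_one] at h

/-! ### The modular lambda function -/

/-- The modular lambda function `ϑ₁₀⁴ / ϑ₀₀⁴`. -/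
noncomputable def modLambda (τ : ℂ) : ℂ := thetaConst 1 0 τ ^ 4 / thetaConst 0 0 τ ^ 4

theorem one_sub_modLambda {τ : ℂ} (hτ : 0 < τ.im) :
    1 - modLambda τ = thetaConst 0 1 τ ^ 4 / thetaConst 0 0 τ ^ 4 := by
  have h := pow_ne_zero 4 (thetaConst_zero_zero_ne_zero hτ)
  rw [modLambda, eq_div_iff h, sub_mul, div_mul_cancel₀ _ h]
  linear_combination thetaConst_jacobi hτ

theorem one_sub_modLambda_ne_zero {τ : ℂ} (hτ : 0 < τ.im) : 1 - modLambda τ ≠ 0 := by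
  rw [one_sub_modLambda hτ]
  exact div_ne_zero (pow_ne_zero 4 (thetaConst_zero_one_ne_zero hτ))
    (pow_ne_zero 4 (thetaConst_zero_zero_ne_zero hτ))

theorem zetaMap_eq {τ : ℂ} (hτ : 0 < τ.im) :
    zetaMap τ = 4 * modLambda τ * (1 - modLambda τ) := by
  have h := thetaConst_zero_zero_ne_zero hτ
  rw [one_sub_modLambda hτ, modLambda, zetaMap]
  field_simp

theorem modLambda_add_one {τ : ℂ} (hτ : 0 < τ.im) :
    modLambda (τ + 1) = -(modLambda τ / (1 - modLambda τ)) := by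
  have h := thetaConst_zero_zero_ne_zero hτ
  have h1 := thetaConst_zero_one_ne_zero hτ
  rw [one_sub_modLambda hτ, modLambda, modLambda, thetaConst_one_zero_add_one_pow_four,
    thetaConst_zero_zero_add_one]
  field_simp

theorem modLambda_add_two (τ : ℂ) : modLambda (τ + 2) = modLambda τ := by
  rw [← one_add_one_eq_two, ← add_assoc, modLambda, thetaConst_one_zero_add_one_pow_four,
    thetaConst_one_zero_add_one_pow_four, thetaConst_zero_zero_add_one,
    thetaConst_zero_one_add_one, neg_neg, modLambda]

theorem modLambda_neg_inv {τ : ℂ} (hτ : 0 < τ.im) : modLambda (-1 / τ) = 1 - modLambda τ := by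
  have h0 := neg_I_mul_ne_zero hτ
  have h := thetaConst_zero_zero_ne_zero hτ
  have h4 : ∀ z : ℂ, z ^ 4 = (z ^ 2) ^ 2 := fun z => by ring
  rw [one_sub_modLambda hτ, modLambda, h4, h4 (thetaConst 0 0 (-1 / τ)),
    thetaConst_one_zero_neg_inv_sq hτ, thetaConst_zero_zero_neg_inv_sq hτ, mul_pow (-I * τ),
    mul_pow (-I * τ),
    mul_div_mul_left _ _ (pow_ne_zero 2 h0), ← pow_mul, ← pow_mul]

theorem modLambda_conj (τ : ℂ) :
    modLambda (-(starRingEnd ℂ) τ) = (starRingEnd ℂ) (modLambda τ) := by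
  rw [modLambda, modLambda, thetaConst_one_zero_conj, thetaConst_zero_zero_conj]
  simp

/-- This removes ϑ₁₀: holomorphy of λ and its limit at i∞ then come from ϑ₀₀ and ϑ₀₁ alone. -/
theorem modLambda_eq_sub_div {τ : ℂ} (hτ : 0 < τ.im) :
    modLambda τ = 1 - thetaConst 0 1 τ ^ 4 / thetaConst 0 0 τ ^ 4 := by
  rw [← one_sub_modLambda hτ, sub_sub_cancel]

theorem isOpen_im_pos : IsOpen {τ : ℂ | 0 < τ.im} := isOpen_lt continuous_const continuous_im

theorem differentiableAt_modLambda {τ : ℂ} (hτ : 0 < τ.im) : DifferentiableAt ℂ modLambda τ := by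
  have h : DifferentiableAt ℂ (fun τ => 1 - thetaConst 0 1 τ ^ 4 / thetaConst 0 0 τ ^ 4) τ :=
    (((differentiableAt_thetaConst_zero_one hτ).pow 4).div
      ((differentiableAt_thetaConst_zero_zero hτ).pow 4)
      (pow_ne_zero 4 (thetaConst_zero_zero_ne_zero hτ))).const_sub 1
  refine h.congr_of_eventuallyEq ?_
  filter_upwards [isOpen_im_pos.mem_nhds hτ] with w hw using modLambda_eq_sub_div hw

theorem eventually_im_gt (M : ℝ) : ∀ᶠ τ : ℂ in comap im atTop, M < τ.im :=
  tendsto_comap.eventually (eventually_gt_atTop M)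

theorem tendsto_modLambda : Tendsto modLambda (comap im atTop) (𝓝 0) := by
  have h := ((tendsto_thetaConst_zero_one.pow 4).div (tendsto_thetaConst_zero_zero.pow 4)
    (by simp)).const_sub 1
  simp only [one_pow, div_one, sub_self] at h
  refine h.congr' ?_
  filter_upwards [eventually_im_gt 0] with τ hτ using (modLambda_eq_sub_div hτ).symm

theorem exists_forall_of_eventually_im {p : ℂ → Prop} (h : ∀ᶠ τ in comap im atTop, p τ) :
    ∃ M : ℝ, 0 < M ∧ ∀ τ : ℂ, M ≤ τ.im → p τ := by
  obtain ⟨s, hs, hp⟩ := mem_comap.1 h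
  obtain ⟨M, hM⟩ := mem_atTop_sets.1 hs
  exact ⟨max M 1, by positivity, fun τ hτ => hp (hM _ ((le_max_left _ _).trans hτ))⟩

/-- On the imaginary axis the theta constants are real, so Jacobi's identity with ϑ₀₁ ≠ 0 gives ϑ₁₀⁴
< ϑ₀₀⁴. -/
theorem norm_modLambda_lt_one_of_re_eq_zero {τ : ℂ} (hτ : 0 < τ.im) (hre : τ.re = 0) :
    ‖modLambda τ‖ < 1 := by
  have hconj : -(starRingEnd ℂ) τ = τ := Complex.ext (by simp [hre]) (by simp)
  have h00 := thetaConst_zero_zero_conj τ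
  have h01 := thetaConst_zero_one_conj τ
  have h10 := thetaConst_one_zero_conj τ
  rw [hconj] at h00 h01 h10
  obtain ⟨a, ha⟩ := conj_eq_iff_real.1 h00.symm
  obtain ⟨b, hb⟩ := conj_eq_iff_real.1 h01.symm
  obtain ⟨c, hc⟩ := conj_eq_iff_real.1 h10.symm
  have hj := thetaConst_jacobi hτ
  have hb0 := thetaConst_zero_one_ne_zero hτ
  rw [ha, hb, hc] at hj
  rw [hb] at hb0
  have hj' : a ^ 4 = b ^ 4 + c ^ 4 := by exact_mod_cast hj
  have hb' : b ≠ 0 := by exact_mod_cast hb0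
  have hb4 : 0 < b ^ 4 := by positivity
  have hc4 : 0 ≤ c ^ 4 := by positivity
  rw [modLambda, ha, hc, ← ofReal_pow, ← ofReal_pow, ← ofReal_div, norm_real, Real.norm_eq_abs,
    abs_of_nonneg (by positivity), div_lt_one (by linarith)]
  linarith

theorem neg_inv_eq_neg_conj {τ : ℂ} (h : ‖τ‖ = 1) : -1 / τ = -(starRingEnd ℂ) τ := by
  have h0 : τ ≠ 0 := fun h0 => by simp [h0] at h
  rw [div_eq_iff h0, neg_mul, mul_comm, mul_conj, normSq_eq_norm_sq, h]
  simp

/-- On the unit circle the inversion -1/τ coincides with the reflection -conj τ. -/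
theorem one_sub_modLambda_of_norm_eq_one {τ : ℂ} (hτ : 0 < τ.im) (h : ‖τ‖ = 1) :
    1 - modLambda τ = (starRingEnd ℂ) (modLambda τ) := by
  rw [← modLambda_neg_inv hτ, neg_inv_eq_neg_conj h, modLambda_conj]

theorem re_modLambda_of_norm_eq_one {τ : ℂ} (hτ : 0 < τ.im) (h : ‖τ‖ = 1) :
    (modLambda τ).re = 1 / 2 := by
  have := congrArg re (one_sub_modLambda_of_norm_eq_one hτ h)
  simp only [sub_re, one_re, conj_re] at this
  linarith

theorem norm_modLambda_add_one_of_norm_eq_one {τ : ℂ} (hτ : 0 < τ.im) (h : ‖τ‖ = 1) :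
    ‖modLambda (τ + 1)‖ = 1 := by
  have h1 := one_sub_modLambda_ne_zero hτ
  rw [modLambda_add_one hτ, norm_neg, norm_div, div_eq_one_iff_eq (norm_ne_zero_iff.2 h1),
    one_sub_modLambda_of_norm_eq_one hτ h, norm_conj]

/-- As λ(τ+1) = -λ/(1-λ), the hypothesis says that λ is closer to 0 than to 1. -/
theorem re_modLambda_lt_half {τ : ℂ} (hτ : 0 < τ.im) (h : ‖modLambda (τ + 1)‖ < 1) :
    (modLambda τ).re < 1 / 2 := by
  have h1 := one_sub_modLambda_ne_zero hτ
  rw [modLambda_add_one hτ, norm_neg, norm_div, div_lt_one (norm_pos_iff.2 h1)] at h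
  have h2 := pow_lt_pow_left₀ h (norm_nonneg _) two_ne_zero
  rw [← normSq_eq_norm_sq, ← normSq_eq_norm_sq, normSq_apply, normSq_apply] at h2
  simp only [sub_re, one_re, sub_im, one_im] at h2
  nlinarith

/-! ### The maximum principle on the fundamental region -/

/-- The interior of the fundamental region. -/
def openRegion : Set ℂ := {τ : ℂ | 0 < τ.im ∧ -1 < τ.re ∧ τ.re < 1 ∧ 1 < ‖τ‖}

/-- The closure of the fundamental region in the upper half plane. -/
def closedRegion : Set ℂ := {τ : ℂ | 0 < τ.im ∧ -1 ≤ τ.re ∧ τ.re ≤ 1 ∧ 1 ≤ ‖τ‖}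

theorem isOpen_openRegion : IsOpen openRegion :=
  (isOpen_lt continuous_const continuous_im).inter <|
    (isOpen_lt continuous_const continuous_re).inter <|
      (isOpen_lt continuous_re continuous_const).inter (isOpen_lt continuous_const continuous_norm)

theorem one_lt_norm_iff {τ : ℂ} : 1 < ‖τ‖ ↔ 1 < τ.re ^ 2 + τ.im ^ 2 := by
  rw [← one_lt_sq_iff₀ (norm_nonneg τ), ← normSq_eq_norm_sq, normSq_apply, sq, sq]

theorem one_le_norm_iff {τ : ℂ} : 1 ≤ ‖τ‖ ↔ 1 ≤ τ.re ^ 2 + τ.im ^ 2 := by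
  rw [← one_le_sq_iff₀ (norm_nonneg τ), ← normSq_eq_norm_sq, normSq_apply, sq, sq]

/-- The region is a convex half strip pushed up by the height √(1-x²) of the circle. -/
theorem isPreconnected_openRegion : IsPreconnected openRegion := by
  have hS : Convex ℝ {z : ℂ | -1 < z.re ∧ z.re < 1 ∧ 0 < z.im} :=
    (convex_halfSpace_re_gt (-1)).inter ((convex_halfSpace_re_lt 1).inter
      (convex_halfSpace_im_gt 0))
  have hφ : Continuous fun z : ℂ => z + (Real.sqrt (1 - z.re ^ 2) : ℂ) * I := by fun_prop
  have himg : (fun z : ℂ => z + (Real.sqrt (1 - z.re ^ 2) : ℂ) * I) ''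
      {z : ℂ | -1 < z.re ∧ z.re < 1 ∧ 0 < z.im} = openRegion := by
    ext τ
    constructor
    · rintro ⟨z, ⟨h1, h2, h3⟩, rfl⟩
      have hs := Real.sqrt_nonneg (1 - z.re ^ 2)
      have hsq := Real.sq_sqrt (show 0 ≤ 1 - z.re ^ 2 by nlinarith)
      refine ⟨?_, ?_, ?_, one_lt_norm_iff.2 ?_⟩ <;> simp <;> nlinarith
    · rintro ⟨h1, h2, h3, h4⟩
      refine ⟨τ - (Real.sqrt (1 - τ.re ^ 2) : ℂ) * I, ⟨by simpa using h2, by simpa using h3, ?_⟩,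
        by simp⟩
      have : Real.sqrt (1 - τ.re ^ 2) < τ.im := by
        rw [Real.sqrt_lt' h1]
        linarith [one_lt_norm_iff.1 h4]
      simpa using this
  rw [← himg]
  exact hS.isPreconnected.image _ hφ.continuousOn

theorem le_im_neg_inv {σ : ℂ} {Y : ℝ} (hY : 0 < Y) (h0 : 0 < σ.im) (h1 : σ.im < 1)
    (h2 : σ.im < 1 / (2 * Y)) (h : |σ.re| ≤ σ.im ^ 2) : Y ≤ (-1 / σ).im := by
  have him : (-1 / σ).im = σ.im / (σ.re ^ 2 + σ.im ^ 2) := by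
    rw [neg_div, neg_im, one_div, inv_im, neg_div, neg_neg, normSq_apply, sq, sq]
  rw [him, le_div_iff₀ (by positivity)]
  rw [lt_div_iff₀ (by positivity)] at h2
  have h3 : σ.re ^ 2 ≤ σ.im ^ 2 := by
    rw [← sq_abs]
    have : σ.im ^ 2 ≤ σ.im := by nlinarith
    exact pow_le_pow_left₀ (abs_nonneg _) (h.trans this) 2
  have h4 : Y * (σ.re ^ 2 + σ.im ^ 2) ≤ Y * (2 * σ.im ^ 2) := by
    gcongr
    linarith
  nlinarith

/-- Near the cusps ±1 put σ = τ ∓ 1. The condition |τ| ≥ 1 forces |Re σ| ≤ (Im σ)², so -1/σ goes to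
i∞ and λ(σ) = 1 - λ(-1/σ) tends to 1. -/
theorem norm_modLambda_near_cusp {c : ℝ} (hc : 1 < c) :
    ∃ δ : ℝ, 0 < δ ∧ ∀ τ ∈ closedRegion, τ.im < δ → ‖modLambda (τ + 1)‖ < c := by
  have hev : ∀ᶠ τ in comap im atTop, ‖modLambda τ‖ < c - 1 := by
    have := tendsto_modLambda.norm
    rw [norm_zero] at this
    exact this.eventually (gt_mem_nhds (by linarith))
  obtain ⟨Y, hY, hM⟩ := exists_forall_of_eventually_im hev
  have key : ∀ σ : ℂ, 0 < σ.im → σ.im < 1 → σ.im < 1 / (2 * Y) → |σ.re| ≤ σ.im ^ 2 →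
      ‖modLambda σ‖ < c := by
    intro σ h0 h1 h2 h3
    have h4 := hM _ (le_im_neg_inv hY h0 h1 h2 h3)
    have h5 : modLambda σ = 1 - modLambda (-1 / σ) := by
      rw [modLambda_neg_inv h0, sub_sub_cancel]
    rw [h5]
    have := norm_sub_le (1 : ℂ) (modLambda (-1 / σ))
    rw [norm_one] at this
    linarith
  refine ⟨min 1 (1 / (2 * Y)), by positivity, fun τ hτ hlt => ?_⟩
  obtain ⟨h0, h1, h2, h3⟩ := hτ
  have h4 := hlt.trans_le (min_le_left _ _)
  have h5 := hlt.trans_le (min_le_right _ _)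
  rw [one_le_norm_iff] at h3
  rcases le_total 0 τ.re with h | h
  · rw [show τ + 1 = (τ - 1) + 2 by ring, modLambda_add_two]
    refine key _ (by simpa using h0) (by simpa using h4) (by simpa using h5) ?_
    simp only [sub_re, one_re, sub_im, one_im, sub_zero]
    rw [abs_le]
    constructor <;> nlinarith
  · refine key _ (by simpa using h0) (by simpa using h4) (by simpa using h5) ?_
    simp only [add_re, one_re, add_im, one_im, add_zero]
    rw [abs_le]
    constructor <;> nlinarith

theorem norm_modLambda_add_one_lt_one_of_re {τ : ℂ} (h0 : 0 < τ.im) (h : τ.re = 1 ∨ τ.re = -1) :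
    ‖modLambda (τ + 1)‖ < 1 := by
  rcases h with h | h
  · rw [show τ + 1 = (τ - 1) + 2 by ring, modLambda_add_two]
    exact norm_modLambda_lt_one_of_re_eq_zero (by simpa using h0) (by simp [h])
  · exact norm_modLambda_lt_one_of_re_eq_zero (by simpa using h0) (by simp [h])

theorem norm_modLambda_add_one_le_one_of_notMem {τ : ℂ} (hτ : τ ∈ closedRegion)
    (h : τ ∉ openRegion) : ‖modLambda (τ + 1)‖ ≤ 1 := by
  obtain ⟨h0, h1, h2, h3⟩ := hτ
  rcases h1.eq_or_lt with h1 | h1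
  · exact (norm_modLambda_add_one_lt_one_of_re h0 (Or.inr h1.symm)).le
  rcases h2.eq_or_lt with h2 | h2
  · exact (norm_modLambda_add_one_lt_one_of_re h0 (Or.inl h2)).le
  rcases h3.eq_or_lt with h3 | h3
  · exact (norm_modLambda_add_one_of_norm_eq_one h0 h3.symm).le
  · exact absurd ⟨h0, h1, h2, h3⟩ h

theorem openRegion_subset_closedRegion : openRegion ⊆ closedRegion := fun _ h =>
  ⟨h.1, h.2.1.le, h.2.2.1.le, h.2.2.2.le⟩

theorem mul_I_mem_openRegion {t : ℝ} (ht : 1 < t) : (t : ℂ) * I ∈ openRegion := by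
  refine ⟨by simpa using one_pos.trans ht, by simp, by simp, ?_⟩
  simpa using ht.trans_le (le_abs_self t)

theorem tendsto_modLambda_add_one :
    Tendsto (fun τ => modLambda (τ + 1)) (comap im atTop) (𝓝 0) :=
  tendsto_modLambda.comp (tendsto_comap_iff.2 (tendsto_comap.congr fun τ => by simp))

theorem tendsto_mul_I_comap : Tendsto (fun t : ℝ => (t : ℂ) * I) atTop (comap im atTop) :=
  tendsto_comap_iff.2 (tendsto_id.congr fun t => by simp)

/-- An interior maximum makes the function constant, and the constant is its limit 0 along the
imaginary axis. -/
theorem modLambda_add_one_eq_zero_of_isMaxOn {τ : ℂ} (hτ : τ ∈ openRegion)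
    (hmax : IsMaxOn (norm ∘ fun τ => modLambda (τ + 1)) openRegion τ) : modLambda (τ + 1) = 0 := by
  have hd : DifferentiableOn ℂ (fun τ => modLambda (τ + 1)) openRegion := fun w hw =>
    ((differentiableAt_modLambda (τ := w + 1) (by simpa using hw.1)).comp w
      (differentiableAt_id.add_const 1)).differentiableWithinAt
  have h := Complex.eqOn_of_isPreconnected_of_isMaxOn_norm isPreconnected_openRegion
    isOpen_openRegion hd hτ hmax
  refine tendsto_nhds_unique (tendsto_const_nhds (f := (atTop : Filter ℝ)))
    ((tendsto_modLambda_add_one.comp tendsto_mul_I_comap).congr' ?_)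
  filter_upwards [eventually_gt_atTop 1] with t ht using h (mul_I_mem_openRegion ht)

/-- On the interior of the fundamental region `|ϑ₁₀| < |ϑ₀₁|`. -/
theorem norm_modLambda_add_one_lt_one {τ₀ : ℂ} (hτ₀ : τ₀ ∈ openRegion) :
    ‖modLambda (τ₀ + 1)‖ < 1 := by
  by_contra! hge
  by_cases hle : ∀ τ ∈ openRegion, ‖modLambda (τ + 1)‖ ≤ 1
  · have := modLambda_add_one_eq_zero_of_isMaxOn hτ₀ fun τ hτ => (hle τ hτ).trans hge
    rw [this, norm_zero] at hge
    linarith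
  push Not at hle
  obtain ⟨τ₁, hτ₁, hc⟩ := hle
  -- If a value of modulus c > 1 occurs, the modulus is below c near the cusps and below 1 near i∞.
  -- The supremum is therefore attained on the compact `K`, and in its open part because the sides
  -- and the arc only give values ≤ 1.
  obtain ⟨δ, hδ, hcusp⟩ := norm_modLambda_near_cusp hc
  obtain ⟨M, hM, hinf⟩ := exists_forall_of_eventually_im
    ((by simpa using tendsto_modLambda_add_one.norm :
      Tendsto (fun τ => ‖modLambda (τ + 1)‖) (comap im atTop) (𝓝 0)).eventually
      (gt_mem_nhds one_pos))
  set K : Set ℂ := {τ | δ ≤ τ.im ∧ τ.im ≤ M ∧ -1 ≤ τ.re ∧ τ.re ≤ 1 ∧ 1 ≤ ‖τ‖}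
  have hKsub : K ⊆ closedRegion := fun τ h =>
    ⟨hδ.trans_le h.1, h.2.2.1, h.2.2.2.1, h.2.2.2.2⟩
  have hKc : IsCompact K := by
    refine Metric.isCompact_of_isClosed_isBounded ?_ ?_
    · exact (isClosed_le continuous_const continuous_im).inter <|
        (isClosed_le continuous_im continuous_const).inter <|
        (isClosed_le continuous_const continuous_re).inter <|
        (isClosed_le continuous_re continuous_const).inter <|
        (isClosed_le continuous_const continuous_norm)
    · refine (Metric.isBounded_closedBall (x := (0 : ℂ)) (r := 1 + M)).subset fun τ h => ?_
      rw [mem_closedBall_zero_iff]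
      refine (norm_le_abs_re_add_abs_im τ).trans (add_le_add (abs_le.2 ⟨h.2.2.1, h.2.2.2.1⟩) ?_)
      rw [abs_of_pos (hδ.trans_le h.1)]
      exact h.2.1
  have hmemK : ∀ τ ∈ openRegion, ‖modLambda (τ₁ + 1)‖ ≤ ‖modLambda (τ + 1)‖ → τ ∈ K := by
    intro τ hτ h
    refine ⟨?_, ?_, hτ.2.1.le, hτ.2.2.1.le, hτ.2.2.2.le⟩
    · by_contra! hlt
      linarith [hcusp τ (openRegion_subset_closedRegion hτ) hlt]
    · by_contra! hlt
      linarith [hinf τ hlt.le]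
  have hcont : ContinuousOn (fun τ => ‖modLambda (τ + 1)‖) K := fun τ hτ => by
    have h : ContinuousAt modLambda (τ + 1) :=
      (differentiableAt_modLambda (by simpa using (hKsub hτ).1)).continuousAt
    exact (h.comp (f := fun τ : ℂ => τ + 1)
      (continuous_add_const 1).continuousAt).norm.continuousWithinAt
  obtain ⟨τm, hτm, hmax⟩ := hKc.exists_isMaxOn ⟨τ₁, hmemK τ₁ hτ₁ le_rfl⟩ hcont
  have h1m : ‖modLambda (τ₁ + 1)‖ ≤ ‖modLambda (τm + 1)‖ := hmax (hmemK τ₁ hτ₁ le_rfl)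
  have hmU : τm ∈ openRegion := by
    by_contra h
    linarith [norm_modLambda_add_one_le_one_of_notMem (hKsub hτm) h]
  have h0 := modLambda_add_one_eq_zero_of_isMaxOn hmU fun τ hτ => by
    rcases le_total ‖modLambda (τ₁ + 1)‖ ‖modLambda (τ + 1)‖ with h | h
    · exact hmax (hmemK τ hτ h)
    · exact h.trans h1m
  rw [h0, norm_zero] at h1m
  linarith

/-! ### The identity F(1/2, 1/2, 1; λ) = ϑ₀₀² -/

theorem eventually_re_theta_quotient_pos :
    ∀ᶠ τ in comap im atTop, 0 < (thetaConst 0 1 τ ^ 2 / thetaConst 0 0 τ ^ 2).re := by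
  have h := (tendsto_thetaConst_zero_one.pow 2).div (tendsto_thetaConst_zero_zero.pow 2) (by simp)
  have h' := (continuous_re.tendsto _).comp h
  simp only [one_pow, div_one, one_re] at h'
  exact h'.eventually (lt_mem_nhds one_pos)

/-- Landen's transformation and the doubling formulas. -/
theorem halfExt_modLambda_two_mul {τ : ℂ} (hτ : 0 < τ.im)
    (hre : 0 < (thetaConst 0 1 τ ^ 2 / thetaConst 0 0 τ ^ 2).re) :
    halfExt (modLambda τ) / thetaConst 0 0 τ ^ 2
      = halfExt (modLambda (2 * τ)) / thetaConst 0 0 (2 * τ) ^ 2 := by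
  have hτ2 : 0 < (2 * τ).im := by simpa using hτ
  -- Positivity of the real part selects this root of 1-λ. Landen's x then satisfies x² = λ(2τ) and
  -- 1+x = ϑ₀₀(τ)²/ϑ₀₀(2τ)².
  have hs : sqrtOneSub (modLambda τ) = thetaConst 0 1 τ ^ 2 / thetaConst 0 0 τ ^ 2 := by
    refine sqrtOneSub_eq_of_sq ?_ (Or.inl hre)
    rw [one_sub_modLambda hτ, div_pow, ← pow_mul, ← pow_mul]
  have ha := pow_ne_zero 2 (thetaConst_zero_zero_ne_zero hτ)
  have ha2 := pow_ne_zero 2 (thetaConst_zero_zero_ne_zero hτ2)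
  have hx := norm_cayley_lt_one hre
  have h1r := one_add_ne_zero_of_re_pos hre
  obtain ⟨h1, h2, -⟩ := thetaConst_two_mul hτ
  have ha0 := thetaConst_zero_zero_ne_zero hτ
  have ha20 := thetaConst_zero_zero_ne_zero hτ2
  have hadd : 1 + thetaConst 0 1 τ ^ 2 / thetaConst 0 0 τ ^ 2
      = 2 * thetaConst 0 0 (2 * τ) ^ 2 / thetaConst 0 0 τ ^ 2 := by
    rw [← h1, add_div, div_self ha]
  have hsub : 1 - thetaConst 0 1 τ ^ 2 / thetaConst 0 0 τ ^ 2
      = 2 * thetaConst 1 0 (2 * τ) ^ 2 / thetaConst 0 0 τ ^ 2 := by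
    rw [← h2, sub_div, div_self ha]
  have hlam : ((1 - thetaConst 0 1 τ ^ 2 / thetaConst 0 0 τ ^ 2)
      / (1 + thetaConst 0 1 τ ^ 2 / thetaConst 0 0 τ ^ 2)) ^ 2 = modLambda (2 * τ) := by
    rw [hadd, hsub, modLambda]
    field_simp
  have hnorm : ‖modLambda (2 * τ)‖ < 1 := by
    rw [← hlam, norm_pow]
    exact pow_lt_one₀ (norm_nonneg _) hx two_ne_zero
  have hone : 1 + (1 - thetaConst 0 1 τ ^ 2 / thetaConst 0 0 τ ^ 2)
      / (1 + thetaConst 0 1 τ ^ 2 / thetaConst 0 0 τ ^ 2)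
      = thetaConst 0 0 τ ^ 2 / thetaConst 0 0 (2 * τ) ^ 2 := by
    rw [one_add_div h1r, add_add_sub_cancel, hadd]
    field_simp
    norm_num
  rw [halfExt_eq_hypDiag hnorm, halfExt, hs, hlam, hone]
  field_simp

/-- The quotient of the two sides is constant along 2ⁿτ and tends to 1. Above height `Y` the
doubling step always applies, since doubling only raises τ. -/
theorem halfExt_modLambda_of_im_large : ∃ Y : ℝ, 0 < Y ∧ ∀ τ : ℂ, Y ≤ τ.im →
    halfExt (modLambda τ) = thetaConst 0 0 τ ^ 2 := by
  obtain ⟨Y, hY, h⟩ := exists_forall_of_eventually_im eventually_re_theta_quotient_pos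
  refine ⟨Y, hY, fun τ hτ => ?_⟩
  have hpos := hY.trans_le hτ
  have hn : ∀ n : ℕ, Y ≤ (2 ^ n * τ).im ∧ halfExt (modLambda (2 ^ n * τ))
      / thetaConst 0 0 (2 ^ n * τ) ^ 2 = halfExt (modLambda τ) / thetaConst 0 0 τ ^ 2 := by
    intro n
    induction n with
    | zero => simpa using hτ
    | succ n ih =>
      obtain ⟨h1, h2⟩ := ih
      rw [pow_succ', mul_assoc, ← halfExt_modLambda_two_mul (hY.trans_le h1) (h _ h1), h2]
      refine ⟨?_, rfl⟩
      have : (2 * (2 ^ n * τ)).im = 2 * (2 ^ n * τ).im := by simp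
      linarith
  have hl : Tendsto (fun τ => halfExt (modLambda τ) / thetaConst 0 0 τ ^ 2) (comap im atTop)
      (𝓝 1) := by
    have h1 := (continuousAt_halfExt zero_mem_cutPlane).tendsto.comp tendsto_modLambda
    rw [halfExt_zero] at h1
    have h2 := h1.div (tendsto_thetaConst_zero_zero.pow 2) (by simp)
    rw [one_pow, div_one] at h2
    exact h2
  have h1 := hl.comp (tendsto_two_pow_mul hpos)
  have h2 := tendsto_nhds_unique
    (tendsto_const_nhds.congr fun n => (hn n).2.symm) h1
  exact (div_eq_one_iff_eq (pow_ne_zero 2 (thetaConst_zero_zero_ne_zero hpos))).1 h2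

/-- In fact Re λ ≤ 1/2, with the circle as the equality case. -/
theorem modLambda_mem_cutPlane {τ : ℂ} (hτ : τ ∈ closedRegion) : modLambda τ ∈ cutPlane := by
  obtain ⟨h0, h1, h2, h3⟩ := hτ
  have key : (modLambda τ).re ≤ 1 / 2 := by
    rcases h3.eq_or_lt with h3 | h3
    · exact (re_modLambda_of_norm_eq_one h0 h3.symm).le
    refine (re_modLambda_lt_half h0 ?_).le
    rcases h1.eq_or_lt with h1 | h1
    · exact norm_modLambda_add_one_lt_one_of_re h0 (Or.inr h1.symm)
    rcases h2.eq_or_lt with h2 | h2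
    · exact norm_modLambda_add_one_lt_one_of_re h0 (Or.inl h2)
    exact norm_modLambda_add_one_lt_one ⟨h0, h1, h2, h3⟩
  exact mem_cutPlane_of_re_lt_one (by linarith)

theorem halfExt_modLambda_of_mem_openRegion {τ : ℂ} (hτ : τ ∈ openRegion) :
    halfExt (modLambda τ) = thetaConst 0 0 τ ^ 2 := by
  obtain ⟨Y, hY, h⟩ := halfExt_modLambda_of_im_large
  have hd1 : DifferentiableOn ℂ (fun τ => halfExt (modLambda τ)) openRegion :=
    differentiableOn_halfExt.comp
      (fun w hw => (differentiableAt_modLambda hw.1).differentiableWithinAt)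
      fun w hw => modLambda_mem_cutPlane (openRegion_subset_closedRegion hw)
  have hd2 : DifferentiableOn ℂ (fun τ => thetaConst 0 0 τ ^ 2) openRegion := fun w hw =>
    ((differentiableAt_thetaConst_zero_zero hw.1).pow 2).differentiableWithinAt
  have hmem : ((Y + 1 : ℝ) : ℂ) * I ∈ openRegion := mul_I_mem_openRegion (by linarith)
  refine (hd1.analyticOnNhd isOpen_openRegion).eqOn_of_preconnected_of_eventuallyEq
    (hd2.analyticOnNhd isOpen_openRegion) isPreconnected_openRegion hmem ?_ hτ
  filter_upwards [(isOpen_lt continuous_const continuous_im).mem_nhds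
    (show Y < (((Y + 1 : ℝ) : ℂ) * I).im by simp)] with w hw using h w (le_of_lt hw)

theorem closedRegion_subset_closure : closedRegion ⊆ closure openRegion := by
  rintro τ ⟨h0, h1, h2, h3⟩
  -- Shrinking the real part by 1-t lowers |τ|² by at most 2t; raising the imaginary part by 2t/Im τ
  -- adds at least 4t.
  have hcont : Continuous fun t : ℝ =>
      (((1 - t) * τ.re : ℝ) : ℂ) + ((τ.im + t * (2 / τ.im) : ℝ) : ℂ) * I := by fun_prop
  have hlim := (hcont.tendsto 0).mono_left (nhdsWithin_le_nhds (s := Set.Ioi (0 : ℝ)))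
  simp only [sub_zero, one_mul, zero_mul, add_zero, re_add_im] at hlim
  refine mem_closure_of_tendsto hlim ?_
  filter_upwards [Ioo_mem_nhdsGT (show (0 : ℝ) < 1 from one_pos)] with t ht
  obtain ⟨ht0, ht1⟩ := ht
  have hre : ((((1 - t) * τ.re : ℝ) : ℂ) + ((τ.im + t * (2 / τ.im) : ℝ) : ℂ) * I).re
      = (1 - t) * τ.re := by simp
  have him : ((((1 - t) * τ.re : ℝ) : ℂ) + ((τ.im + t * (2 / τ.im) : ℝ) : ℂ) * I).im
      = τ.im + t * (2 / τ.im) := by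
    simp only [add_im, ofReal_im, mul_im, ofReal_re, I_im, I_re]
    ring
  have hd : 0 < t * (2 / τ.im) := by positivity
  refine ⟨?_, ?_, ?_, one_lt_norm_iff.2 ?_⟩
  · rw [him]
    linarith
  · rw [hre]
    nlinarith
  · rw [hre]
    nlinarith
  · rw [hre, him]
    rw [one_le_norm_iff] at h3
    have hx : τ.re ^ 2 ≤ 1 := by nlinarith
    have hprod : τ.im * (t * (2 / τ.im)) = 2 * t := by field_simp
    have : (τ.im + t * (2 / τ.im)) ^ 2 = τ.im ^ 2 + 4 * t + (t * (2 / τ.im)) ^ 2 := by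
      linear_combination 2 * hprod
    rw [this]
    nlinarith [sq_nonneg (t * τ.re), sq_nonneg (t * (2 / τ.im))]

theorem continuousAt_thetaConst_zero_zero {τ : ℂ} (hτ : 0 < τ.im) :
    ContinuousAt (thetaConst 0 0) τ := (differentiableAt_thetaConst_zero_zero hτ).continuousAt

/-- `F(1/2, 1/2, 1; λ(τ)) = ϑ₀₀(τ)²` on the closed fundamental region. -/
theorem halfExt_modLambda {τ : ℂ} (hτ : τ ∈ closedRegion) :
    halfExt (modLambda τ) = thetaConst 0 0 τ ^ 2 := by
  have hne : (𝓝[openRegion] τ).NeBot :=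
    mem_closure_iff_nhdsWithin_neBot.1 (closedRegion_subset_closure hτ)
  have h1 : Tendsto (fun τ => halfExt (modLambda τ)) (𝓝[openRegion] τ)
      (𝓝 (halfExt (modLambda τ))) :=
    ((continuousAt_halfExt (modLambda_mem_cutPlane hτ)).tendsto.comp
      (differentiableAt_modLambda hτ.1).continuousAt.tendsto).mono_left nhdsWithin_le_nhds
  have h2 : Tendsto (fun τ => thetaConst 0 0 τ ^ 2) (𝓝[openRegion] τ) (𝓝 (thetaConst 0 0 τ ^ 2)) :=
    ((continuousAt_thetaConst_zero_zero hτ.1).tendsto.pow 2).mono_left nhdsWithin_le_nhds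
  refine tendsto_nhds_unique h1 (h2.congr' ?_)
  filter_upwards [self_mem_nhdsWithin] with w hw using (halfExt_modLambda_of_mem_openRegion hw).symm

/-! ### The sign of Im λ on the unit circle -/

theorem conj_thetaConst_sq_of_norm_eq_one {τ : ℂ} (hτ : 0 < τ.im) (h : ‖τ‖ = 1) :
    (starRingEnd ℂ) (thetaConst 0 0 τ ^ 2) = -I * τ * thetaConst 0 0 τ ^ 2 := by
  rw [← thetaConst_zero_zero_neg_inv_sq hτ, neg_inv_eq_neg_conj h, thetaConst_zero_zero_conj,
    map_pow]

theorem re_le_one_of_norm_eq_one {τ : ℂ} (h : ‖τ‖ = 1) : -1 ≤ τ.re ∧ τ.re ≤ 1 :=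
  abs_le.1 (h ▸ abs_re_le_norm τ)

theorem mem_closedRegion_of_norm_eq_one {τ : ℂ} (hτ : 0 < τ.im) (h : ‖τ‖ = 1) :
    τ ∈ closedRegion :=
  ⟨hτ, (re_le_one_of_norm_eq_one h).1, (re_le_one_of_norm_eq_one h).2, h.ge⟩

theorem modLambda_I : modLambda I = 1 / 2 := by
  have h := modLambda_neg_inv (τ := I) (by simp)
  rw [show -1 / I = I by rw [div_eq_iff I_ne_zero, I_mul_I]] at h
  linear_combination h / 2

theorem thetaConst_zero_zero_I_sq : thetaConst 0 0 I ^ 2 = halfExt (1 / 2) := by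
  rw [← modLambda_I, halfExt_modLambda (mem_closedRegion_of_norm_eq_one (by simp) (by simp))]

/-- Equal values of λ force ϑ₀₀(τ)² = ϑ₀₀(i)². The relation conj(ϑ₀₀²) = -iτϑ₀₀² then recovers τ
from that nonzero value. -/
theorem eq_I_of_modLambda_eq_half {τ : ℂ} (hτ : 0 < τ.im) (h : ‖τ‖ = 1)
    (hl : modLambda τ = 1 / 2) : τ = I := by
  have h1 := halfExt_modLambda (mem_closedRegion_of_norm_eq_one hτ h)
  have h2 := conj_thetaConst_sq_of_norm_eq_one hτ h
  have h3 := conj_thetaConst_sq_of_norm_eq_one (τ := I) (by simp) (by simp)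
  rw [hl, ← thetaConst_zero_zero_I_sq] at h1
  rw [← h1, h3] at h2
  have h4 := pow_ne_zero 2 (thetaConst_zero_zero_ne_zero (τ := I) (by simp))
  have h5 := mul_right_cancel₀ h4 h2
  exact (mul_left_cancel₀ (neg_ne_zero.2 I_ne_zero) h5).symm

theorem modLambda_eq_half_add {τ : ℂ} (hτ : 0 < τ.im) (h : ‖τ‖ = 1) :
    modLambda τ = 1 / 2 + (modLambda τ).im * I := by
  refine Complex.ext ?_ ?_
  · simp [re_modLambda_of_norm_eq_one hτ h]
  · simp

theorem im_modLambda_ne_zero {τ : ℂ} (hτ : 0 < τ.im) (h : ‖τ‖ = 1) (hre : τ.re ≠ 0) :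
    (modLambda τ).im ≠ 0 := by
  intro h0
  have h1 := modLambda_eq_half_add hτ h
  rw [h0] at h1
  refine hre ?_
  rw [eq_I_of_modLambda_eq_half hτ h (by simpa using h1), I_re]

/-- The point of the upper unit semicircle with real part `x`. -/
noncomputable def circlePoint (x : ℝ) : ℂ := x + (Real.sqrt (1 - x ^ 2) : ℂ) * I

theorem circlePoint_re (x : ℝ) : (circlePoint x).re = x := by simp [circlePoint]

theorem circlePoint_im (x : ℝ) : (circlePoint x).im = Real.sqrt (1 - x ^ 2) := by
  simp [circlePoint]

theorem circlePoint_im_pos {x : ℝ} (h0 : 0 ≤ x) (h1 : x < 1) : 0 < (circlePoint x).im := by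
  rw [circlePoint_im]
  exact Real.sqrt_pos.2 (by nlinarith)

theorem norm_eq_one_iff_sq {τ : ℂ} : ‖τ‖ = 1 ↔ τ.re ^ 2 + τ.im ^ 2 = 1 := by
  rw [← pow_eq_one_iff_of_nonneg (norm_nonneg τ) two_ne_zero, ← normSq_eq_norm_sq,
    normSq_apply, sq, sq]

theorem norm_circlePoint {x : ℝ} (h0 : 0 ≤ x) (h1 : x < 1) : ‖circlePoint x‖ = 1 := by
  rw [norm_eq_one_iff_sq, circlePoint_im, circlePoint_re, Real.sq_sqrt (by nlinarith)]
  ring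

theorem circlePoint_of_norm_eq_one {τ : ℂ} (hτ : 0 < τ.im) (h : ‖τ‖ = 1) :
    circlePoint τ.re = τ := by
  refine Complex.ext (circlePoint_re _) ?_
  rw [norm_eq_one_iff_sq] at h
  rw [circlePoint_im, show 1 - τ.re ^ 2 = τ.im ^ 2 by linarith, Real.sqrt_sq hτ.le]

theorem continuous_circlePoint : Continuous circlePoint := by
  unfold circlePoint
  fun_prop

theorem circlePoint_zero : circlePoint 0 = I := by simp [circlePoint]

theorem continuousAt_modLambda_circlePoint {x : ℝ} (h0 : 0 ≤ x) (h1 : x < 1) :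
    ContinuousAt (fun x => modLambda (circlePoint x)) x :=
  (differentiableAt_modLambda (circlePoint_im_pos h0 h1)).continuousAt.comp
    continuous_circlePoint.continuousAt

/-- Write G = ϑ₀₀² = F(1/2,1/2,1;λ). Near λ = 1/2 the signs of Im G and Im λ agree, and conj G =
-iτG gives (1 + Im τ) Im G = Re τ · Re G > 0. -/
theorem eventually_im_modLambda_circlePoint_pos :
    ∀ᶠ x : ℝ in 𝓝[>] 0, 0 < (modLambda (circlePoint x)).im := by
  have hl : Tendsto (fun x => modLambda (circlePoint x)) (𝓝[>] 0) (𝓝 (1 / 2)) := by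
    have := (continuousAt_modLambda_circlePoint le_rfl one_pos).tendsto
    simp only [circlePoint_zero, modLambda_I] at this
    exact this.mono_left nhdsWithin_le_nhds
  have hI : 0 < (thetaConst 0 0 I ^ 2).re := by
    rw [thetaConst_zero_zero_I_sq, halfExt_eq_hypDiag (by norm_num)]
    exact hypDiag_half_at_half.2.1
  have hth : Tendsto (fun x => (thetaConst 0 0 (circlePoint x) ^ 2).re) (𝓝[>] 0)
      (𝓝 (thetaConst 0 0 I ^ 2).re) := by
    have h1 : ContinuousAt (fun τ => (thetaConst 0 0 τ ^ 2).re) (circlePoint 0) :=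
      continuous_re.continuousAt.comp
        ((continuousAt_thetaConst_zero_zero (circlePoint_im_pos le_rfl one_pos)).pow 2)
    have h2 := (h1.comp (f := circlePoint) continuous_circlePoint.continuousAt).tendsto
    simp only [Function.comp_def, circlePoint_zero] at h2
    exact h2.mono_left nhdsWithin_le_nhds
  have him : Tendsto (fun x => (modLambda (circlePoint x)).im) (𝓝[>] 0) (𝓝[≠] 0) := by
    refine tendsto_nhdsWithin_iff.2 ⟨?_, ?_⟩
    · have := (continuous_im.tendsto _).comp hl
      rw [show (1 / 2 : ℂ).im = 0 by norm_num] at this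
      exact this
    · filter_upwards [Ioo_mem_nhdsGT one_pos] with x hx
      exact im_modLambda_ne_zero (circlePoint_im_pos hx.1.le hx.2) (norm_circlePoint hx.1.le hx.2)
        (by rw [circlePoint_re]; exact hx.1.ne')
  have hnorm : ∀ᶠ x in 𝓝[>] (0 : ℝ), ‖modLambda (circlePoint x)‖ < 1 :=
    hl.norm.eventually (gt_mem_nhds (by norm_num))
  filter_upwards [him.eventually eventually_im_hypDiag_half_div_pos,
    hth.eventually (lt_mem_nhds hI), hnorm, Ioo_mem_nhdsGT one_pos] with x h1 h2 h3 hx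
  have hpos := circlePoint_im_pos hx.1.le hx.2
  have hn := norm_circlePoint hx.1.le hx.2
  rw [← modLambda_eq_half_add hpos hn, ← halfExt_eq_hypDiag h3,
    halfExt_modLambda (mem_closedRegion_of_norm_eq_one hpos hn)] at h1
  have h4 := congrArg im (conj_thetaConst_sq_of_norm_eq_one hpos hn)
  set G := thetaConst 0 0 (circlePoint x) ^ 2
  set τ := circlePoint x with hτ
  have hre : τ.re = x := circlePoint_re x
  simp only [conj_im, mul_im, mul_re, neg_re, I_re, neg_im, I_im, hre] at h4
  have h5 : 0 < G.im := by
    have h6 : G.im * (1 + τ.im) = x * G.re := by linarith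
    have h7 : 0 < x * G.re := mul_pos hx.1 h2
    rw [← h6] at h7
    exact (pos_iff_pos_of_mul_pos h7).2 (by linarith)
  exact (div_pos_iff_of_pos_left h5).1 h1

/-- On the right half of the unit circle `λ` has positive imaginary part. -/
theorem im_modLambda_pos {τ : ℂ} (hτ : 0 < τ.im) (h : ‖τ‖ = 1) (hre : 0 < τ.re) :
    0 < (modLambda τ).im := by
  have hre1 : τ.re < 1 := by
    rw [norm_eq_one_iff_sq] at h
    nlinarith
  -- A non-positive value would, by the intermediate value theorem against the positive values near
  -- i, give a zero of Im λ on the right arc.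
  by_contra! hle
  obtain ⟨x, hx, hx0, hxr⟩ := (eventually_im_modLambda_circlePoint_pos.and
    (Ioo_mem_nhdsGT hre)).exists
  have hc : ContinuousOn (fun x => (modLambda (circlePoint x)).im) (Set.Icc x τ.re) := fun y hy =>
    (continuous_im.continuousAt.comp (continuousAt_modLambda_circlePoint (hx0.le.trans hy.1)
      (hy.2.trans_lt hre1))).continuousWithinAt
  have hiv := intermediate_value_Icc' hxr.le hc
  obtain ⟨y, hy, hy0⟩ := hiv ⟨by rwa [circlePoint_of_norm_eq_one hτ h], hx.le⟩
  have hy1 := hx0.le.trans hy.1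
  have hy2 := hy.2.trans_lt hre1
  exact im_modLambda_ne_zero (circlePoint_im_pos hy1 hy2) (norm_circlePoint hy1 hy2)
    (by rw [circlePoint_re]; exact (hx0.trans_le hy.1).ne') hy0

/-! ### Branch selection and the main theorem -/

theorem regionD12_im_pos {τ : ℂ} (hτ : τ ∈ regionD12) : 0 < τ.im :=
  hτ.elim (fun h => h.1) fun h => h.1

theorem regionD12_subset_closedRegion : regionD12 ⊆ closedRegion := by
  rintro τ (⟨h0, h1, h2, h3⟩ | ⟨h0, h1, h2, h3⟩)
  · exact ⟨h0, h1.le, h2, h3.le⟩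
  · exact mem_closedRegion_of_norm_eq_one h0 h1

/-- Only the right half of the arc belongs to the region, so Im λ > 0 there, in agreement with
taking values on the cut from above. -/
theorem regionD12_cases {τ : ℂ} (hτ : τ ∈ regionD12) : (modLambda τ).re < 1 / 2 ∨
    ((modLambda τ).re = 1 / 2 ∧ 0 < (modLambda τ).im) ∨ τ = I := by
  rcases hτ with ⟨h0, h1, h2, h3⟩ | ⟨h0, h1, h2, h3⟩
  · left
    refine re_modLambda_lt_half h0 ?_
    rcases h2.eq_or_lt with h2 | h2
    · exact norm_modLambda_add_one_lt_one_of_re h0 (Or.inl h2)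
    · exact norm_modLambda_add_one_lt_one ⟨h0, h1, h2, h3⟩
  · right
    rcases h2.eq_or_lt with h2 | h2
    · right
      rw [← circlePoint_of_norm_eq_one h0 h1, ← h2, circlePoint_zero]
    · exact Or.inl ⟨re_modLambda_of_norm_eq_one h0 h1, im_modLambda_pos h0 h1 h2⟩

theorem modLambda_eq_half_iff {τ : ℂ} (hτ : τ ∈ regionD12) : modLambda τ = 1 / 2 ↔ τ = I := by
  refine ⟨fun h => ?_, fun h => h ▸ modLambda_I⟩
  rcases regionD12_cases hτ with h1 | ⟨-, h1⟩ | h1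
  · rw [h] at h1
    norm_num at h1
  · rw [h] at h1
    norm_num at h1
  · exact h1

/-- From 1-ζ = (1-2λ)²: the three cases for λ are exactly the admissible ones for the branch, with
value 0 at τ = i. -/
theorem sqrtOneSub_zetaMap {τ : ℂ} (hτ : τ ∈ regionD12) :
    sqrtOneSub (zetaMap τ) = 1 - 2 * modLambda τ := by
  refine sqrtOneSub_eq_of_sq ?_ ?_
  · rw [zetaMap_eq (regionD12_im_pos hτ)]
    ring
  · have hre : (1 - 2 * modLambda τ).re = 1 - 2 * (modLambda τ).re := by simp
    have him : (1 - 2 * modLambda τ).im = -(2 * (modLambda τ).im) := by simp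
    rw [hre, him]
    rcases regionD12_cases hτ with h1 | ⟨h1, h2⟩ | h1
    · left
      linarith
    · right
      constructor <;> linarith
    · right
      rw [h1, modLambda_I]
      norm_num

theorem quarterExt_zetaMap {τ : ℂ} (hτ : τ ∈ regionD12) :
    quarterExt (zetaMap τ) = thetaConst 0 0 τ ^ 2 := by
  rw [quarterExt, sqrtOneSub_zetaMap hτ, ← halfExt_modLambda (regionD12_subset_closedRegion hτ)]
  congr 1
  ring

theorem zetaMap_eq_one_iff {τ : ℂ} (hτ : τ ∈ regionD12) : zetaMap τ = 1 ↔ τ = I := by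
  rw [← modLambda_eq_half_iff hτ, zetaMap_eq (regionD12_im_pos hτ)]
  constructor
  · intro h
    have h1 : (1 - 2 * modLambda τ) ^ 2 = 0 := by linear_combination -h
    have h2 := pow_eq_zero_iff two_ne_zero |>.1 h1
    linear_combination -h2 / 2
  · intro h
    rw [h]
    norm_num

theorem thetaConst_sub_eq {τ : ℂ} (hτ : 0 < τ.im) :
    thetaConst 0 1 τ ^ 4 - thetaConst 1 0 τ ^ 4
      = thetaConst 0 0 τ ^ 4 * (1 - 2 * modLambda τ) := by
  have h := thetaConst_zero_zero_ne_zero hτ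
  have h1 : thetaConst 0 0 τ ^ 4 * modLambda τ = thetaConst 1 0 τ ^ 4 := by
    rw [modLambda]
    field_simp
  linear_combination 2 * h1 - thetaConst_jacobi hτ

theorem mainTheorem1 :
    -- the two functions are well defined
    IsSingleValuedHypergeometric (1 / 4) (1 / 4) 1 (hypergeometricF (1 / 4) (1 / 4) 1) ∧
    IsSingleValuedHypergeometric (3 / 4) (3 / 4) 1 (hypergeometricF (3 / 4) (3 / 4) 1) ∧
    -- no denominator vanishes, and `ζ` takes the value `1` in the region only at `i`
    (∀ τ ∈ regionD12, thetaConst 0 0 τ ≠ 0) ∧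
    (∀ τ ∈ regionD12, zetaMap τ = 1 ↔ τ = I) ∧
    (∀ τ ∈ regionD12, thetaConst 0 1 τ ^ 4 - thetaConst 1 0 τ ^ 4 = 0 ↔ τ = I) ∧
    -- the two formulas
    (∀ τ ∈ regionD12, τ ≠ I →
      hypergeometricF (1 / 4) (1 / 4) 1 (zetaMap τ) = thetaConst 0 0 τ ^ 2) ∧
    (∀ τ ∈ regionD12, τ ≠ I →
      hypergeometricF (3 / 4) (3 / 4) 1 (zetaMap τ) =
        thetaConst 0 0 τ ^ 6 / (thetaConst 0 1 τ ^ 4 - thetaConst 1 0 τ ^ 4)) ∧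
    -- the first formula at `τ = i`, where `F(1/4, 1/4, 1; 1)` is the limit from the unit disk
    Tendsto (hypergeometricF (1 / 4) (1 / 4) 1) (𝓝[{z : ℂ | ‖z‖ < 1}] 1)
      (𝓝 (thetaConst 0 0 I ^ 2)) := by
  refine ⟨isSingleValued_hypergeometricF isSingleValued_quarterExt,
    isSingleValued_hypergeometricF isSingleValued_quarterExt_div,
    fun τ hτ => thetaConst_zero_zero_ne_zero (regionD12_im_pos hτ),
    fun τ hτ => zetaMap_eq_one_iff hτ, fun τ hτ => ?_, fun τ hτ hI => ?_, fun τ hτ hI => ?_, ?_⟩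
  · have h := pow_ne_zero 4 (thetaConst_zero_zero_ne_zero (regionD12_im_pos hτ))
    rw [thetaConst_sub_eq (regionD12_im_pos hτ), mul_eq_zero, or_iff_right h,
      ← modLambda_eq_half_iff hτ]
    constructor
    · intro h
      linear_combination -h / 2
    · intro h
      linear_combination -2 * h
  · rw [hypergeometricF_eq isSingleValued_quarterExt (mt (zetaMap_eq_one_iff hτ).1 hI),
      quarterExt_zetaMap hτ]
  · rw [hypergeometricF_eq isSingleValued_quarterExt_div (mt (zetaMap_eq_one_iff hτ).1 hI),
      quarterExt_zetaMap hτ, sqrtOneSub_zetaMap hτ, thetaConst_sub_eq (regionD12_im_pos hτ),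
      show thetaConst 0 0 τ ^ 6 = thetaConst 0 0 τ ^ 4 * thetaConst 0 0 τ ^ 2 by ring,
      mul_div_mul_left _ _ (pow_ne_zero 4 (thetaConst_zero_zero_ne_zero (regionD12_im_pos hτ)))]
  -- At z = 1 the root vanishes, so the inner argument is 1/2 = λ(i).
  · have h1 : quarterExt 1 = thetaConst 0 0 I ^ 2 := by
      rw [quarterExt, sqrtOneSub_one, thetaConst_zero_zero_I_sq, sub_zero]
    rw [← h1]
    refine ((tendsto_quarterExt continuousAt_sqrtOneSub_one.tendsto).mono_left
      nhdsWithin_le_nhds).congr' ?_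
    filter_upwards [self_mem_nhdsWithin] with z hz
    refine (hypergeometricF_eq isSingleValued_quarterExt fun h => ?_).symm
    have hz' : ‖z‖ < 1 := hz
    simp [h] at hz'
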